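/- Let $d \ge 3$ and $\mathbf{p} = (p_1, \dots, p_d) \in [0,1]^d$. For $i = 1, \dots, d$ let $\mathcal{P}_i = \{v \in \mathbb{Z}^d : v_i = 0\}$. Independently for all $i$ and all $w \in \mathcal{P}_i$, remove from $\mathbb{Z}^d$, with probability $1 - p_i$, the entire line $\{w + z e_i : z \in \mathbb{Z}\}$. Let $\mathcal{V}$ be the random set of vertices of $\mathbb{Z}^d$ that have not been removed (the vacant set), and let $\mathbb{P}_{\mathbf{p}}$ be its law. Let $\{\mathbf{0} \leftrightarrow \infty\}$ be the event that there is an infinite self-avoiding nearest-neighbor path in $\mathcal{V}$ starting at the origin (equivalently, that the origin lies in an infinite connected component of $\mathcal{V}$). For an integer $n \ge 0$ let $B(n) = [-n,n]^d \cap \mathbb{Z}^d$, let $\partial B(n)$ be the set of sites of $B(n)$ having a nearest neighbor outside $B(n)$, and let $\{\mathbf{0} \leftrightarrow \partial B(n)\}$ be the event that a nearest-neighbor path in $\mathcal{V}$ connects the origin to $\partial B(n)$. Let $p_c(\mathbb{Z}^{d-1})$ be the critical probability of Bernoulli site percolation on $\mathbb{Z}^{d-1}$, that is, the infimum of the $p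 \in [0,1]$ for which the origin lies in an infinite open path with positive probability. 1. If $p_i < p_c(\mathbb{Z}^{d-1})$ for some $i$ and $p_j \ne 1$ for some $j \ne i$, then $\mathbb{P}_{\mathbf{p}}(\mathbf{0} \leftrightarrow \infty) = 0$. 2. There is an $\varepsilon = \varepsilon(d) > 0$ such that $\mathbb{P}_{\mathbf{p}}(\mathbf{0} \leftrightarrow \infty) > 0$ whenever $p_i > 1 - \varepsilon$ for all $i = 1, \dots, d$. 3. If $p_i < p_c(\mathbb{Z}^{d-1})$ and $p_j < p_c(\mathbb{Z}^{d-1})$ for some $i \ne j$, then there is a constant $\psi = \psi(\mathbf{p}, d) > 0$ such that $\mathbb{P}_{\mathbf{p}}(\mathbf{0} \leftrightarrow \partial B(n)) \le e^{-\psi n}$ for all integers $n \ge 0$. -/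

import Mathlib

open MeasureTheory ProbabilityTheory unitInterval

namespace LinePercolation

/-- The nearest-neighbour graph on `ℤ^m`: two sites are adjacent when their `ℓ¹`-distance is `1`. -/
def lattice (m : ℕ) : SimpleGraph (Fin m → ℤ) where
  Adj x y := ∑ i, |x i - y i| = 1
  symm := ⟨fun x y h => by simpa only [abs_sub_comm] using h⟩
  loopless := ⟨fun x h => by simp at h⟩

/-- Site configurations on `ℤ^m`; `true` means open (vacant), `false` means closed (removed). -/
abbrev Config (m : ℕ) : Type := (Fin m → ℤ) → Bool

/-- The vacant set `𝒱(η)` of a configuration: the set of its open sites. -/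
def vacant {m : ℕ} (η : Config m) : Set (Fin m → ℤ) := {v | η v = true}

/-- The event `{0 ↔ ∞}`: there is an infinite self-avoiding nearest-neighbour path of open sites
starting at the origin. -/
def connInfty (m : ℕ) : Set (Config m) :=
  {η | ∃ γ : ℕ → (Fin m → ℤ), γ 0 = 0 ∧ Function.Injective γ ∧
    (∀ k, (lattice m).Adj (γ k) (γ (k + 1))) ∧ ∀ k, γ k ∈ vacant η}

/-- The box `B(n) = [-n, n]^m ∩ ℤ^m`. -/
def box (m n : ℕ) : Set (Fin m → ℤ) := {v | ∀ i, |v i| ≤ (n : ℤ)}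

/-- `∂B(n)`: the sites of `B(n)` that have a nearest neighbour outside `B(n)`. -/
def boxBoundary (m n : ℕ) : Set (Fin m → ℤ) :=
  {v | v ∈ box m n ∧ ∃ w, (lattice m).Adj v w ∧ w ∉ box m n}

/-- The event `{0 ↔ ∂B(n)}`: a nearest-neighbour path of open sites (both end points included)
joins the origin to `∂B(n)`. -/
def connBoundary (m n : ℕ) : Set (Config m) :=
  {η | ∃ v ∈ boxBoundary m n, ∃ γ : (lattice m).Walk 0 v,
    γ.IsPath ∧ ∀ u ∈ γ.support, u ∈ vacant η}

/-- The product measure on `{0,1}^S` under which the sites are independent, each of them open with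
probability `p`. -/
noncomputable def bernoulliField (S : Type) (p : I) : Measure (S → Bool) :=
  Measure.infinitePi fun _ : S => bernoulliMeasure true false p

instance (S : Type) (p : I) : IsProbabilityMeasure (bernoulliField S p) := by
  unfold bernoulliField; infer_instance

/-- The critical probability of Bernoulli site percolation on `ℤ^m`:
the infimum of all `p ∈ [0,1]` with `P_p(0 ↔ ∞) > 0`. -/
noncomputable def criticalProb (m : ℕ) : ℝ :=
  sInf {p : ℝ | ∃ q : I, (q : ℝ) = p ∧ 0 < bernoulliField (Fin m → ℤ) q (connInfty m)}

/-- The coordinate hyperplane `𝒫_i` of `ℤ^d`. Its points index the lines parallel to `e_i`. -/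
abbrev Hyperplane (d : ℕ) (i : Fin d) : Type := {v : Fin d → ℤ // v i = 0}

/-- The orthogonal projection `π_i : ℤ^d → 𝒫_i`; two sites lie on the same line parallel to `e_i`
exactly when they have the same projection. -/
def proj {d : ℕ} (i : Fin d) (v : Fin d → ℤ) : Hyperplane d i :=
  ⟨Function.update v i 0, by simp⟩

/-- Line configurations `(ω_1, …, ω_d)`: `ω i w = false` means that the line parallel to `e_i`
through `w` is removed. -/
abbrev LineConfig (d : ℕ) : Type := (i : Fin d) → Hyperplane d i → Bool

/-- The site configuration `ω(v) = ∏ i, ω_i (π_i v)`: a site is open iff none of the `d` lines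
through it is removed. -/
def siteConfig (d : ℕ) (ω : LineConfig d) : Config d :=
  fun v => decide (∀ i, ω i (proj i v) = true)

/-- The map from line to site configurations is measurable, so that its law below is not a junk
value. -/
theorem measurable_siteConfig (d : ℕ) : Measurable (siteConfig d) := by
  refine measurable_pi_iff.2 fun v => ?_
  have h : Measurable fun ω : LineConfig d => fun i => ω i (proj i v) :=
    measurable_pi_iff.2 fun i => (measurable_pi_apply (proj i v)).comp (measurable_pi_apply i)
  exact (measurable_of_countable fun b : Fin d → Bool => decide (∀ i, b i = true)).comp h

/-- Bernoulli line percolation on `ℤ^d` with parameter vector `p`: the law on `{0,1}^{ℤ^d}` of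
`siteConfig` under `P_{p_1} × ⋯ × P_{p_d}`. -/
noncomputable def linePercolation (d : ℕ) (p : Fin d → I) : Measure (Config d) :=
  (Measure.pi fun i => bernoulliField (Hyperplane d i) (p i)).map (siteConfig d)

end LinePercolation

/-! All lines together form one independent Bernoulli family (`linePercolation_eq`), so events read
off disjoint sets of lines are independent (`bernoulliProd_inter`).

Parts 1 and 3 rest on projection. Forgetting coordinate `i` turns an open cluster of `ℤ^d` into a
connected set that is open for the site percolation on `ℤ^(d-1)` formed by the lines parallel to
`e_i` (`Link.slice`); this percolation is subcritical when `p_i < p_c`. In part 1 the projected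
cluster is therefore almost surely a finite set. Over a finite set `C`, different heights in
direction `e_i` involve disjoint sets of lines parallel to `e_j`, and each height is entirely closed
over `C` with probability at least `(1 - p_j)^|C|`. So some height above and some height below the
origin are blocked (`ae_exists_blocked_height`), and the cluster is trapped between them. In part 3
a far site has a large coordinate `k`, and `k ≠ i` or `k ≠ j`; projecting along that direction keeps
the coordinate, so a subcritical cluster on `ℤ^(d-1)` reaches distance `n`.

Exponential decay below `p_c` is proved by the Duminil-Copin–Tassion argument. If `exitMean` is
below `1` for some finite `S ∋ 0`, a long path needs many successive independent exits, and its
probability decays geometrically (`reach_far_le_pow`). If instead `exitMean` is at least `1` for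
every such `S` at some `p > 0`, the same holds at larger parameters. Exploration from the boundary
of a box then gives `F' ≥ x - F` for the probability `F` of reaching the boundary
(`prob_unexplored_le` with half of Russo's formula). Hence `F(q)` is bounded below uniformly in the
box for `q > p`, which is impossible for `p < q < p_c`.

Part 2 lives near the plane `x + y + z = 0` of the first three coordinates, where no two sites share
a line. Sites thickened so as to connect neighbours form a planar field with dependence of range one
(`disjoint_planeLines`). A hierarchy of `5 × 5` blocks handles it: a block is bad only if it
contains two separated, hence independent, bad sub-blocks, so bad probabilities are squared at each
level (`prob_bad_le`), while good blocks carry connected backbones that link up with those of good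
neighbours (`backbone_connected`). -/

namespace LinePercolation

/-! ### Product Bernoulli measures, finitary events and independence. -/

section Bernoulli

variable {ι : Type*}

/-- The product of Bernoulli measures with site-dependent parameters. -/
noncomputable def bernoulliProd (q : ι → I) : Measure (ι → Bool) :=
  Measure.infinitePi fun i => bernoulliMeasure true false (q i)

instance (q : ι → I) : IsProbabilityMeasure (bernoulliProd q) := by
  unfold bernoulliProd; infer_instance

/-- The σ-algebra generated by the coordinates in `T`. -/
abbrev coordSigma (T : Set ι) : MeasurableSpace (ι → Bool) :=
  ⨆ i ∈ T, MeasurableSpace.comap (fun ω => ω i) ⊤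

theorem coordSigma_le (T : Set ι) : coordSigma T ≤ MeasurableSpace.pi :=
  iSup₂_le fun i _ => le_iSup (fun i => MeasurableSpace.comap (fun ω : ι → Bool => ω i) ⊤) i

theorem coordSigma_mono {T T' : Set ι} (h : T ⊆ T') : coordSigma T ≤ coordSigma T' :=
  biSup_mono h

theorem measurable_eval_coordSigma {T : Set ι} {i : ι} (hi : i ∈ T) :
    @Measurable _ _ (coordSigma T) _ fun ω : ι → Bool => ω i := by
  have h : MeasurableSpace.comap (fun ω : ι → Bool => ω i) ⊤ ≤ coordSigma T :=
    le_iSup₂ (f := fun i (_ : i ∈ T) => MeasurableSpace.comap (fun ω : ι → Bool => ω i) ⊤) i hi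
  exact (comap_measurable _).mono h le_rfl

theorem measurableSet_of_dependsOn {T : Set ι} (F : Finset ι) (hF : ↑F ⊆ T)
    {A : Set (ι → Bool)} (hA : ∀ ω ω' : ι → Bool, (∀ i ∈ F, ω i = ω' i) → ω ∈ A → ω' ∈ A) :
    MeasurableSet[coordSigma T] A := by
  let r : (ι → Bool) → (F → Bool) := fun ω i => ω i
  have hr : @Measurable _ _ (coordSigma T) _ r :=
    @measurable_pi_lambda _ _ _ (coordSigma T) _ _ fun i =>
      measurable_eval_coordSigma (hF i.2)
  have : A = r ⁻¹' (r '' A) := by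
    refine Set.Subset.antisymm (Set.subset_preimage_image _ _) ?_
    rintro ω ⟨ω', h', he⟩
    exact hA ω' ω (fun i hi => congrFun he ⟨i, hi⟩) h'
  rw [this]
  exact hr (Set.toFinite _).measurableSet

/-- Only countably many finite witnesses exist. Connection events are treated this way, with the
open sites of a path as witness. -/
theorem measurableSet_finitary [Countable ι] {T : Set ι} (𝒜 : Set (Finset ι))
    (h𝒜 : ∀ s ∈ 𝒜, (↑s : Set ι) ⊆ T) :
    MeasurableSet[coordSigma T] {ω : ι → Bool | ∃ s ∈ 𝒜, ∀ i ∈ s, ω i = true} := by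
  have : {ω : ι → Bool | ∃ s ∈ 𝒜, ∀ i ∈ s, ω i = true} =
      ⋃ s ∈ 𝒜, {ω : ι → Bool | ∀ i ∈ s, ω i = true} := by ext; simp
  rw [this]
  refine MeasurableSet.biUnion (Set.to_countable _) fun s hs => ?_
  refine measurableSet_of_dependsOn s (h𝒜 s hs) fun ω ω' h hω i hi => ?_
  rw [← h i hi]; exact hω i hi

theorem bernoulliProd_inter (q : ι → I) {T T' : Set ι} (hT : Disjoint T T')
    {A B : Set (ι → Bool)} (hA : MeasurableSet[coordSigma T] A)
    (hB : MeasurableSet[coordSigma T'] B) :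
    bernoulliProd q (A ∩ B) = bernoulliProd q A * bernoulliProd q B := by
  have h1 : iIndepFun (fun (i : ι) (ω : ι → Bool) => ω i) (bernoulliProd q) :=
    iIndepFun_infinitePi (X := fun _ (b : Bool) => b) (fun _ => measurable_id)
  have h2 : iIndep (fun i : ι => MeasurableSpace.comap (fun ω : ι → Bool => ω i) ⊤)
      (bernoulliProd q) := h1
  have h3 := indep_iSup_of_disjoint (fun i => (measurable_pi_apply i).comap_le) h2 hT
  exact (Indep_iff _ _ _).1 h3 A B hA hB

theorem bernoulliProd_map (q : ι → I) {κ : Type*} {f : κ → ι} (hf : Function.Injective f) :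
    (bernoulliProd q).map (fun ω k => ω (f k)) = bernoulliProd fun k => q (f k) :=
  Measure.map_infinitePi_infinitePi_of_inj
    (P := fun i => bernoulliMeasure true false (q i)) hf

theorem bernoulliProd_forall_eq (q : ι → I) (s : Finset ι) (b : ι → Bool) :
    bernoulliProd q {ω | ∀ i ∈ s, ω i = b i} =
      ∏ i ∈ s, bernoulliMeasure true false (q i) {b i} := by
  rw [← Measure.infinitePi_pi (fun i => bernoulliMeasure true false (q i)) (s := s) (t := fun i => {b i})
    (fun _ _ => measurableSet_singleton _)]
  rfl

theorem bernoulliMeasure_true (p : I) :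
    bernoulliMeasure true false p {true} = ENNReal.ofReal p := by
  rw [bernoulliMeasure_apply_of_mem_of_notMem _ (by simp) (by simp)]
  · rw [ENNReal.ofReal]; congr 1; ext; simp [p.2.1]
  all_goals simp

theorem bernoulliMeasure_false (p : I) :
    bernoulliMeasure true false p {false} = ENNReal.ofReal (1 - p) := by
  rw [bernoulliMeasure_apply_of_notMem_of_mem _ (by simp) (by simp)]
  · rw [ENNReal.ofReal]; congr 1; ext; simp [p.2.2]
  all_goals simp

theorem bernoulliProd_eval (q : ι → I) (i : ι) :
    bernoulliProd q {ω | ω i = true} = ENNReal.ofReal (q i) := by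
  have := bernoulliProd_forall_eq q {i} fun _ => true
  rw [Finset.prod_singleton, bernoulliMeasure_true] at this
  simpa using this

theorem bernoulliProd_eval_false (q : ι → I) (i : ι) :
    bernoulliProd q {ω | ω i = false} = ENNReal.ofReal (1 - q i) := by
  have := bernoulliProd_forall_eq q {i} fun _ => false
  rw [Finset.prod_singleton, bernoulliMeasure_false] at this
  simpa using this

end Bernoulli

/-! ### Connection inside a vertex set, and Kőnig's lemma. -/

section Link

variable {V : Type*} {G : SimpleGraph V} {O O' : Set V} {x y z : V}

/-- `x` and `y` are joined by a path of `G` all of whose vertices lie in `O`. -/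
def Link (G : SimpleGraph V) (O : Set V) (x y : V) : Prop :=
  x ∈ O ∧ Relation.ReflTransGen (fun a b => G.Adj a b ∧ b ∈ O) x y

theorem Link.refl (hx : x ∈ O) : Link G O x x := ⟨hx, .refl⟩

theorem Link.left (h : Link G O x y) : x ∈ O := h.1

theorem Link.tail (h : Link G O x y) (ha : G.Adj y z) (hz : z ∈ O) : Link G O x z :=
  ⟨h.1, h.2.tail ⟨ha, hz⟩⟩

@[elab_as_elim]
theorem Link.induct {P : V → Prop} (h : Link G O x y) (h0 : x ∈ O → P x)
    (hs : ∀ a b, Link G O x a → G.Adj a b → b ∈ O → P a → P b) : P y := by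
  obtain ⟨hx, h⟩ := h
  induction h with
  | refl => exact h0 hx
  | tail h1 h2 ih => exact hs _ _ ⟨hx, h1⟩ h2.1 h2.2 ih

theorem Link.right (h : Link G O x y) : y ∈ O :=
  h.induct (fun h => h) fun _ _ _ _ hb _ => hb

theorem Link.trans (h : Link G O x y) (h' : Link G O y z) : Link G O x z :=
  ⟨h.1, h.2.trans h'.2⟩

theorem Link.of_adj (hx : x ∈ O) (hy : y ∈ O) (h : G.Adj x y) : Link G O x y :=
  (Link.refl hx).tail h hy

theorem Link.symm (h : Link G O x y) : Link G O y x :=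
  h.induct (fun h => .refl h) fun _ _ h1 ha hb ih => (Link.of_adj hb h1.right ha.symm).trans ih

theorem Link.mono (hO : O ⊆ O') (h : Link G O x y) : Link G O' x y :=
  h.induct (fun h => .refl (hO h)) fun _ _ _ ha hb ih => ih.tail ha (hO hb)

theorem Link.map {W : Type*} {H : SimpleGraph W} {U : Set W} {f : V → W}
    (hf : ∀ a b, G.Adj a b → H.Adj (f a) (f b) ∨ f a = f b) (hO : ∀ a ∈ O, f a ∈ U)
    (h : Link G O x y) : Link H U (f x) (f y) :=
  h.induct (fun h => .refl (hO _ h)) fun a b _ hab hb ih => by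
    rcases hf a b hab with h | h
    · exact ih.tail h (hO _ hb)
    · exact h ▸ ih

theorem Link.exists_finset (h : Link G O x y) :
    ∃ s : Finset V, (↑s : Set V) ⊆ O ∧ Link G ↑s x y := by
  classical
  refine h.induct (fun h => ⟨{x}, by simpa, .refl (by simp)⟩) ?_
  rintro a b - hab hb ⟨s, hs, hl⟩
  refine ⟨insert b s, ?_, (hl.mono (by simp)).tail hab (by simp)⟩
  rw [Finset.coe_insert]
  exact Set.insert_subset hb hs

/-- A path that leaves `C` runs outside `C` after its last visit to `C`. -/
theorem Link.last_exit {C : Set V} (h : Link G O x z) (hx : x ∈ C) :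
    z ∉ C → ∃ a ∈ C, ∃ b, G.Adj a b ∧ Link G O x a ∧ Link G (O \ C) b z := by
  refine h.induct (fun _ h => absurd hx h) ?_
  intro a b hl hab hb ih hbC
  by_cases ha : a ∈ C
  · exact ⟨a, ha, b, hab, hl, .refl ⟨hb, hbC⟩⟩
  · obtain ⟨c, hc, d, hcd, hl', hl''⟩ := ih ha
    exact ⟨c, hc, d, hcd, hl', hl''.tail hab ⟨hb, hbC⟩⟩

theorem Link.of_walk (γ : G.Walk x y) (h : ∀ u ∈ γ.support, u ∈ O) : Link G O x y := by
  induction γ with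
  | nil => exact .refl (h _ (by simp))
  | cons ha p ih =>
    have h1 := ih fun u hu => h u (by simp [hu])
    exact (Link.of_adj (h _ (by simp)) h1.left ha).trans h1

theorem Link.of_seq {γ : ℕ → V} (ha : ∀ k, G.Adj (γ k) (γ (k + 1))) (ho : ∀ k, γ k ∈ O) (n : ℕ) :
    Link G O (γ 0) (γ n) := by
  induction n with
  | zero => exact .refl (ho 0)
  | succ n ih => exact ih.tail (ha n) (ho _)

/-- Kőnig's lemma: an infinite cluster contains an infinite self-avoiding path. -/
theorem exists_path_of_infinite (hG : ∀ x, {y | G.Adj x y}.Finite)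
    (h : {y | Link G O x y}.Infinite) :
    ∃ γ : ℕ → V, γ 0 = x ∧ Function.Injective γ ∧ (∀ k, G.Adj (γ k) (γ (k + 1))) ∧
      ∀ k, γ k ∈ O := by
  -- A state is a set of used vertices and a current vertex whose cluster off the used ones is still
  -- infinite.
  let St := {s : Set V × V // {y | Link G (O \ s.1) s.2 y}.Infinite}
  have step : ∀ s : St, ∃ t : St, t.1.1 = insert s.1.2 s.1.1 ∧ G.Adj s.1.2 t.1.2 := by
    rintro ⟨⟨F, a⟩, hs⟩
    by_contra! hcon
    refine hs (Set.Finite.subset (((hG a).biUnion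
      (t := fun b => {z | Link G (O \ insert a F) b z}) ?_).insert a) ?_)
    · intro b hb
      by_contra hinf
      exact hcon ⟨⟨insert a F, b⟩, hinf⟩ rfl hb
    · intro z hz
      by_cases hza : z = a
      · exact .inl hza
      -- After its last visit to `a`, the path lies in the cluster of a neighbour of `a` off `insert
      -- a F`; were all of these finite, so would be the cluster of `a`.
      · obtain ⟨c, hc, b, hcb, -, hl⟩ := Link.last_exit (C := {a}) hz rfl hza
        obtain rfl : c = a := hc
        refine .inr (Set.mem_biUnion (x := b) hcb (hl.mono ?_))
        rintro u ⟨⟨h1, h2⟩, h3⟩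
        refine ⟨h1, ?_⟩
        rintro (h | h)
        exacts [h3 h, h2 h]
  choose nxt hn1 hn2 using step
  let st : ℕ → St := fun n => Nat.rec ⟨(∅, x), by simpa using h⟩ (fun _ s => nxt s) n
  have hs1 : ∀ n, (st (n + 1)).1.1 = insert (st n).1.2 (st n).1.1 := fun n => hn1 _
  have hmem : ∀ n, (st n).1.2 ∈ O \ (st n).1.1 := fun n => by
    obtain ⟨y, hy⟩ := (st n).2.nonempty
    exact hy.left
  have hsub : ∀ n k, k < n → (st k).1.2 ∈ (st n).1.1 := by
    intro n
    induction n with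
    | zero => simp
    | succ n ih =>
      intro k hk
      rw [hs1]
      rcases Nat.lt_succ_iff_lt_or_eq.1 hk with h | rfl
      · exact .inr (ih k h)
      · exact .inl rfl
  refine ⟨fun n => (st n).1.2, rfl, ?_, fun k => hn2 _, fun k => (hmem k).1⟩
  have hne : ∀ k n, k < n → (st k).1.2 ≠ (st n).1.2 := fun k n hkn he =>
    (hmem n).2 (he ▸ hsub n k hkn)
  intro k n he
  by_contra hkn
  rcases Nat.lt_or_gt_of_ne hkn with h | h
  exacts [hne _ _ h he, hne _ _ h he.symm]

end Link

/-! ### Connection events, cluster exploration and the exit inequality. -/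

section Events

variable {V : Type*}

/-- The set of open sites of a configuration. -/
def openSet (ω : V → Bool) : Set V := {v | ω v = true}

theorem mem_openSet {ω : V → Bool} {v : V} : v ∈ openSet ω ↔ ω v = true := Iff.rfl

theorem measurableSet_exists_link [Countable V] (G : SimpleGraph V) (S : Set V)
    (R : V → V → Prop) :
    MeasurableSet[coordSigma S]
      {ω : V → Bool | ∃ x y, R x y ∧ Link G (openSet ω ∩ S) x y} := by
  have := measurableSet_finitary (T := S)
    {s : Finset V | (↑s : Set V) ⊆ S ∧ ∃ x y, R x y ∧ Link G ↑s x y} fun s hs => hs.1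
  convert this using 1
  ext ω
  constructor
  · rintro ⟨x, y, hR, hl⟩
    obtain ⟨s, hs, hl'⟩ := hl.exists_finset
    exact ⟨s, ⟨fun u hu => (hs hu).2, x, y, hR, hl'⟩, fun i hi => (hs hi).1⟩
  · rintro ⟨s, ⟨hs, x, y, hR, hl⟩, ho⟩
    exact ⟨x, y, hR, hl.mono fun u hu => ⟨ho u hu, hs hu⟩⟩

/-- The event that the cluster of `o` meets `A`. -/
def reach (G : SimpleGraph V) (o : V) (A : Set V) : Set (V → Bool) :=
  {ω | ∃ z ∈ A, Link G (openSet ω) o z}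

theorem measurableSet_reach [Countable V] (G : SimpleGraph V) (o : V) (A : Set V) :
    MeasurableSet (reach G o A) := by
  refine coordSigma_le Set.univ _ ?_
  convert measurableSet_exists_link G Set.univ (fun x y => x = o ∧ y ∈ A) using 1
  ext ω
  simp only [reach, Set.mem_ofPred_eq, Set.inter_univ]
  constructor
  · rintro ⟨z, hz, h⟩
    exact ⟨o, z, ⟨rfl, hz⟩, h⟩
  · rintro ⟨x, z, ⟨rfl, hz⟩, h⟩
    exact ⟨z, hz, h⟩

/-- The expected number of sites outside `S` adjacent to the cluster of `o` in `S`. -/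
noncomputable def exitMean (G : SimpleGraph V) (p : I) (o : V) (S : Set V) : ENNReal :=
  ∑' y, bernoulliProd (fun _ => p)
    {ω : V → Bool | y ∉ S ∧ ∃ x ∈ S, G.Adj x y ∧ Link G (openSet ω ∩ S) o x}

/-- The sites of `C` are open and the other sites of `S` adjacent to `C` are closed. For connected
`C ∋ o` this means that `C` is the open cluster of `o` in `S`. -/
def clusterEvent (G : SimpleGraph V) (S C : Finset V) : Set (V → Bool) :=
  {ω | (∀ x ∈ C, ω x = true) ∧ ∀ x ∈ S, x ∉ C → (∃ a ∈ C, G.Adj a x) → ω x = false}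

theorem link_iff_of_clusterEvent {G : SimpleGraph V} {o : V} {S C : Finset V} (hCS : C ⊆ S)
    (hC : ∀ x ∈ C, Link G ↑C o x) (ho : o ∈ C) {ω : V → Bool} (hω : ω ∈ clusterEvent G S C)
    (x : V) : Link G (openSet ω ∩ S) o x ↔ x ∈ C := by
  constructor
  · intro h
    refine h.induct (fun _ => ho) ?_
    intro a b _ hab hb ha
    by_contra hbC
    have := hω.2 b hb.2 hbC ⟨a, ha, hab⟩
    exact absurd hb.1 (by simp [mem_openSet, this])
  · intro h
    exact (hC x h).mono fun u hu => ⟨hω.1 u hu, hCS hu⟩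

open Classical in
/-- The connected subsets of `S` that contain `o`. -/
noncomputable def clusters (G : SimpleGraph V) (S : Finset V) (o : V) : Finset (Finset V) :=
  S.powerset.filter fun C => o ∈ C ∧ ∀ x ∈ C, Link G ↑C o x

theorem mem_clusters {G : SimpleGraph V} {S C : Finset V} {o : V} :
    C ∈ clusters G S o ↔ C ⊆ S ∧ o ∈ C ∧ ∀ x ∈ C, Link G ↑C o x := by
  simp [clusters]

theorem exists_clusterEvent {G : SimpleGraph V} {o : V} {S : Finset V} (ho : o ∈ S)
    {ω : V → Bool} (hω : ω o = true) : ∃ C ∈ clusters G S o, ω ∈ clusterEvent G S C := by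
  classical
  have key : ∀ x, Link G (openSet ω ∩ S) o x → x ∈ S := fun x h => h.right.2
  refine ⟨S.filter fun x => Link G (openSet ω ∩ S) o x, mem_clusters.2 ⟨by simp, ?_, ?_⟩, ?_, ?_⟩
  · simpa [ho] using Link.refl (G := G) (O := openSet ω ∩ S) ⟨hω, ho⟩
  · intro x hx
    refine (Finset.mem_filter.1 hx).2.induct (fun h => .refl ?_) fun a b hl hab hb ih =>
      ih.tail hab ?_
    · simpa [ho] using Link.refl (G := G) (O := openSet ω ∩ S) ⟨hω, ho⟩
    · simpa using ⟨hb.2, hl.tail hab hb⟩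
  · intro x hx
    exact (Finset.mem_filter.1 hx).2.right.1
  · intro x hx hxC ⟨a, ha, hax⟩
    by_contra h
    rw [Bool.not_eq_false] at h
    exact hxC (Finset.mem_filter.2 ⟨hx, (Finset.mem_filter.1 ha).2.tail hax ⟨h, hx⟩⟩)

/-- Only `C` and its outer boundary within `S` are revealed; everything else stays independent of
the cluster. -/
theorem measurableSet_clusterEvent (G : SimpleGraph V) (S C : Finset V) (hCS : C ⊆ S) :
    MeasurableSet[coordSigma {x | x ∈ C ∨ x ∈ S ∧ ∃ a ∈ C, G.Adj a x}]
      (clusterEvent G S C) := by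
  classical
  refine measurableSet_of_dependsOn (S.filter fun x => x ∈ C ∨ ∃ a ∈ C, G.Adj a x) ?_ ?_
  · intro x hx
    rw [Finset.mem_coe, Finset.mem_filter] at hx
    exact hx.2.imp_right fun h => ⟨hx.1, h⟩
  · intro ω ω' h hω
    refine ⟨fun x hx => ?_, fun x hx hxC ha => ?_⟩
    · rw [← h x (Finset.mem_filter.2 ⟨hCS hx, .inl hx⟩)]; exact hω.1 x hx
    · rw [← h x (Finset.mem_filter.2 ⟨hx, .inr ha⟩)]; exact hω.2 x hx hxC ha

/-- The events for different `C` are disjoint, since each determines the cluster of `o` in `S`. -/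
theorem sum_clusterEvent_le [Countable V] (G : SimpleGraph V) (q : V → I) (o y : V) (S : Finset V) :
    ∑ C ∈ clusters G S o, bernoulliProd q {ω | (y ∉ S ∧ ∃ a ∈ C, G.Adj a y) ∧
        ω ∈ clusterEvent G S C} ≤
      bernoulliProd q {ω | y ∉ (S : Set V) ∧ ∃ x ∈ (S : Set V), G.Adj x y ∧
        Link G (openSet ω ∩ S) o x} := by
  rw [← measure_biUnion_finset]
  · refine measure_mono ?_
    intro ω hω
    simp only [Set.mem_iUnion] at hω
    obtain ⟨C, hC, ⟨hy, a, ha, hay⟩, hω⟩ := hω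
    obtain ⟨hCS, ho, hcon⟩ := mem_clusters.1 hC
    exact ⟨hy, a, hCS ha, hay, (link_iff_of_clusterEvent hCS hcon ho hω a).2 ha⟩
  · intro C hC C' hC' hne
    refine Set.disjoint_left.2 fun ω h h' => hne ?_
    obtain ⟨hCS, ho, hcon⟩ := mem_clusters.1 hC
    obtain ⟨hCS', ho', hcon'⟩ := mem_clusters.1 hC'
    ext x
    rw [← link_iff_of_clusterEvent hCS hcon ho h.2 x,
      ← link_iff_of_clusterEvent hCS' hcon' ho' h'.2 x]
  · intro C hC
    exact (MeasurableSet.const _).inter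
      (coordSigma_le _ _ (measurableSet_clusterEvent G S C (mem_clusters.1 hC).1))

/-- A path from `o` to a set disjoint from `S` exits the cluster of `o` in `S`, and continues
independently of it. -/
theorem reach_le_exitMean_mul [Countable V] (G : SimpleGraph V) (p : I) {o : V} {S : Finset V}
    (ho : o ∈ S) {A : Set V} (hA : ∀ z ∈ A, z ∉ S) {c : ENNReal}
    (hc : ∀ y x, x ∈ S → G.Adj x y → bernoulliProd (fun _ => p) (reach G y A) ≤ c) :
    bernoulliProd (fun _ => p) (reach G o A) ≤ exitMean G p o S * c := by
  set μ := bernoulliProd (fun _ : V => p)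
  let T : Finset V → Set V := fun C => {x | x ∈ C ∨ x ∈ S ∧ ∃ a ∈ C, G.Adj a x}
  let B : Finset V → V → Set (V → Bool) := fun C y =>
    {ω | ∃ b z, (b = y ∧ z ∈ A) ∧ Link G (openSet ω ∩ (T C)ᶜ) b z}
  let D : Finset V → V → Set (V → Bool) := fun C y =>
    {ω | (y ∉ S ∧ ∃ a ∈ C, G.Adj a y) ∧ ω ∈ clusterEvent G S C}
  have hsub : reach G o A ⊆ ⋃ C ∈ clusters G S o, ⋃ y, D C y ∩ B C y := by
    rintro ω ⟨z, hz, hl⟩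
    obtain ⟨C, hC, hω⟩ := exists_clusterEvent (G := G) ho hl.left
    obtain ⟨hCS, hoC, hcon⟩ := mem_clusters.1 hC
    -- After the last exit from `C` the path avoids all of `T C`, because the boundary of `C` in `S`
    -- is closed. In particular `b ∉ S`.
    obtain ⟨a, ha, b, hab, -, hl'⟩ := hl.last_exit (C := ↑C) hoC fun h => hA z hz (hCS h)
    have hclosed : ∀ u ∈ openSet ω \ ↑C, u ∈ openSet ω ∩ (T C)ᶜ := by
      rintro u ⟨hu, huC⟩
      refine ⟨hu, ?_⟩
      rintro (h | ⟨h, h'⟩)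
      · exact huC h
      · have := hω.2 u h huC h'
        exact absurd hu (by simp [mem_openSet, this])
    have hb := hclosed b hl'.left
    simp only [Set.mem_iUnion]
    refine ⟨C, hC, b, ⟨⟨fun hbS => hb.2 (.inr ⟨hbS, a, ha, hab⟩), a, ha, hab⟩, hω⟩, b, z,
      ⟨rfl, hz⟩, hl'.mono hclosed⟩
  have hDB : ∀ C ∈ clusters G S o, ∀ y, μ (D C y ∩ B C y) ≤ μ (D C y) * c := by
    intro C hC y
    by_cases hy : y ∉ S ∧ ∃ a ∈ C, G.Adj a y
    · obtain ⟨hCS, hoC, hcon⟩ := mem_clusters.1 hC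
      have hD : D C y = clusterEvent G S C := by
        ext ω; exact ⟨fun h => h.2, fun h => ⟨hy, h⟩⟩
      rw [hD, bernoulliProd_inter _ (disjoint_compl_right (a := T C))
        (measurableSet_clusterEvent G S C hCS) (measurableSet_exists_link G _ _)]
      obtain ⟨-, a, ha, hay⟩ := hy
      refine mul_le_mul_right ((measure_mono ?_).trans (hc y a (hCS ha) hay)) _
      rintro ω ⟨b, z, ⟨rfl, hz⟩, hl⟩
      exact ⟨z, hz, hl.mono Set.inter_subset_left⟩
    · have : D C y = ∅ := by
        ext ω; exact ⟨fun h => absurd h.1 hy, fun h => h.elim⟩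
      simp [this]
  calc μ (reach G o A) ≤ μ (⋃ C ∈ clusters G S o, ⋃ y, D C y ∩ B C y) := measure_mono hsub
    _ ≤ ∑ C ∈ clusters G S o, μ (⋃ y, D C y ∩ B C y) := measure_biUnion_finset_le _ _
    _ ≤ ∑ C ∈ clusters G S o, ∑' y, μ (D C y ∩ B C y) :=
        Finset.sum_le_sum fun _ _ => measure_iUnion_le _
    _ ≤ ∑ C ∈ clusters G S o, ∑' y, μ (D C y) * c :=
        Finset.sum_le_sum fun C hC => ENNReal.tsum_le_tsum fun y => hDB C hC y
    _ = (∑' y, ∑ C ∈ clusters G S o, μ (D C y)) * c := by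
        rw [Summable.tsum_finsetSum fun _ _ => ENNReal.summable, Finset.sum_mul]
        simp_rw [ENNReal.tsum_mul_right]
    _ ≤ exitMean G p o S * c :=
        mul_le_mul_left (ENNReal.tsum_le_tsum fun y => sum_clusterEvent_le G _ o y S) _

end Events

/-! ### Boxes, infinite clusters as a limit, and iteration of the exit inequality. -/

section Lattice

variable {m : ℕ}

theorem lattice_adj_coord {x y : Fin m → ℤ} (h : (lattice m).Adj x y) (i : Fin m) :
    |x i - y i| ≤ 1 := by
  have h' : ∑ i, |x i - y i| = 1 := h
  rw [← h']
  exact Finset.single_le_sum (f := fun i => |x i - y i|) (fun _ _ => abs_nonneg _)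
    (Finset.mem_univ i)

theorem lattice_locallyFinite (x : Fin m → ℤ) : {y | (lattice m).Adj x y}.Finite := by
  refine (Set.Finite.pi' fun i => Set.finite_Icc (x i - 1) (x i + 1)).subset ?_
  intro y hy i
  have := abs_le.1 (lattice_adj_coord hy i)
  exact ⟨by linarith, by linarith⟩

theorem finite_box (m n : ℕ) : (box m n).Finite := by
  refine (Set.Finite.pi' fun i => Set.finite_Icc (-(n : ℤ)) n).subset ?_
  intro y hy i
  exact abs_le.1 (hy i)

/-- The sites at `ℓ^∞`-distance at least `n` from the origin. -/
def far (m n : ℕ) : Set (Fin m → ℤ) := {v | ∃ k, (n : ℤ) ≤ |v k|}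

theorem not_mem_box_iff {n : ℕ} {v : Fin m → ℤ} : v ∉ box m n ↔ v ∈ far m (n + 1) := by
  simp only [box, far, Set.mem_ofPred_eq, not_forall, not_le]
  refine exists_congr fun k => ?_
  push_cast
  omega

theorem mem_connInfty_iff {η : Config m} :
    η ∈ connInfty m ↔ {v | Link (lattice m) (openSet η) 0 v}.Infinite := by
  constructor
  · rintro ⟨γ, h0, hinj, hadj, ho⟩
    refine (Set.infinite_range_of_injective hinj).mono ?_
    rintro _ ⟨n, rfl⟩
    rw [← h0]
    exact Link.of_seq hadj ho n
  · intro h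
    exact exists_path_of_infinite lattice_locallyFinite h

theorem connInfty_eq : connInfty m = ⋂ n, reach (lattice m) 0 (far m n) := by
  ext η
  rw [mem_connInfty_iff, Set.mem_iInter]
  constructor
  · intro h n
    by_contra hcon
    refine h ((finite_box m n).subset fun v hv => ?_)
    by_contra hvb
    obtain ⟨k, hk⟩ := not_mem_box_iff.1 hvb
    exact hcon ⟨v, ⟨k, by push_cast at hk; omega⟩, hv⟩
  · intro h hfin
    have : ∀ k : Fin m, BddAbove ((fun v : Fin m → ℤ => |v k|) ''
        {v | Link (lattice m) (openSet η) 0 v}) := fun k => (hfin.image _).bddAbove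
    choose b hb using this
    obtain ⟨v, ⟨k, hk⟩, hv⟩ := h (∑ k, (b k).toNat + 1)
    have h1 : |v k| ≤ b k := hb k ⟨v, hv, rfl⟩
    have h2 : (b k).toNat ≤ ∑ k, (b k).toNat :=
      Finset.single_le_sum (f := fun k => (b k).toNat) (fun _ _ => Nat.zero_le _) (Finset.mem_univ k)
    push_cast at hk
    zify at h2
    have h3 := Int.self_le_toNat (b k)
    linarith

theorem measurableSet_connInfty : MeasurableSet (connInfty m) := by
  rw [connInfty_eq]
  exact MeasurableSet.iInter fun n => measurableSet_reach _ _ _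

theorem far_anti : Antitone (far m) := fun a b hab _ ⟨k, hk⟩ =>
  ⟨k, le_trans (by exact_mod_cast hab) hk⟩

theorem reach_mono {V : Type*} {G : SimpleGraph V} {o : V} {A B : Set V} (h : A ⊆ B) :
    reach G o A ⊆ reach G o B := fun _ ⟨z, hz, hl⟩ => ⟨z, h hz, hl⟩

/-- A site with a coordinate of size `n + L` keeps one of size `n` when seen from `b`, and the law
is translation invariant. -/
theorem bernoulliProd_reach_translate (p : I) (b : Fin m → ℤ) {n L : ℕ} (hb : ∀ k, |b k| ≤ L) :
    bernoulliProd (fun _ => p) (reach (lattice m) b (far m (n + L))) ≤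
      bernoulliProd (fun _ => p) (reach (lattice m) 0 (far m n)) := by
  have hmap := bernoulliProd_map (fun _ : Fin m → ℤ => p) (add_left_injective b)
  conv_rhs => rw [← hmap, Measure.map_apply (by fun_prop) (measurableSet_reach _ _ _)]
  refine measure_mono ?_
  rintro ω ⟨z, ⟨k, hk⟩, hl⟩
  refine ⟨z - b, ⟨k, ?_⟩, ?_⟩
  · have := abs_sub_abs_le_abs_sub (z k) (b k)
    have := hb k
    push_cast at hk
    simp only [Pi.sub_apply]
    linarith
  · have := Link.map (H := lattice m) (f := fun v => v - b)
      (U := openSet fun v => ω (v + b)) ?_ ?_ hl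
    · simpa using this
    · intro x y h
      left
      have h' : ∑ i, |x i - y i| = 1 := h
      simpa [lattice] using h'
    · intro a ha
      simpa [openSet] using ha

/-- An exit from `S` lands within distance `L` of the origin, so each factor `exitMean` costs only
`L` of the distance to cover. -/
theorem reach_far_le_pow (p : I) {S : Finset (Fin m → ℤ)} (h0 : 0 ∈ S) {L : ℕ}
    (hL : ∀ v ∈ S, ∀ k, |v k| < L) (k : ℕ) :
    bernoulliProd (fun _ => p) (reach (lattice m) 0 (far m (k * L))) ≤
      exitMean (lattice m) p 0 S ^ k := by
  induction k with
  | zero => simpa using prob_le_one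
  | succ k ih =>
    rw [pow_succ', Nat.succ_mul]
    refine (reach_le_exitMean_mul (lattice m) p h0 (c := bernoulliProd (fun _ => p)
      (reach (lattice m) 0 (far m (k * L)))) ?_ ?_).trans (mul_le_mul_right ih _)
    · rintro z ⟨j, hj⟩ hz
      have := hL z hz j
      push_cast at hj
      have : (0 : ℤ) ≤ k * L := by positivity
      linarith
    · intro y x hx hxy
      refine bernoulliProd_reach_translate p y fun j => ?_
      have h1 := lattice_adj_coord hxy j
      have h2 := hL x hx j
      rw [abs_sub_comm] at h1
      have h3 := abs_sub_abs_le_abs_sub (y j) (x j)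
      omega

end Lattice

/-! ### Local events as polynomials in the parameter, and half of Russo's formula. -/

section Russo

variable {V : Type*}

/-- `A` depends on the sites of `Λ` only. -/
def Local (Λ : Finset V) (A : Set (V → Bool)) : Prop :=
  ∀ ω ω' : V → Bool, (∀ i ∈ Λ, ω i = ω' i) → ω ∈ A → ω' ∈ A

open Classical in
/-- The configuration whose open sites are those of `T`. -/
noncomputable def indicatorConfig (T : Finset V) : V → Bool := fun v => decide (v ∈ T)

theorem indicatorConfig_eq_true {T : Finset V} {v : V} : indicatorConfig T v = true ↔ v ∈ T := by
  simp [indicatorConfig]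

theorem indicatorConfig_eq_false {T : Finset V} {v : V} :
    indicatorConfig T v = false ↔ v ∉ T := by
  simp [indicatorConfig]

open Classical in
/-- The probability of `A` under Bernoulli percolation on `Λ`, as a polynomial. -/
noncomputable def probPoly (Λ : Finset V) (A : Set (V → Bool)) (x : ℝ) : ℝ :=
  ∑ T ∈ Λ.powerset with indicatorConfig T ∈ A, x ^ T.card * (1 - x) ^ (Λ.card - T.card)

theorem probPoly_nonneg (Λ : Finset V) (A : Set (V → Bool)) {x : ℝ} (h0 : 0 ≤ x) (h1 : x ≤ 1) :
    0 ≤ probPoly Λ A x :=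
  Finset.sum_nonneg fun _ _ => mul_nonneg (pow_nonneg h0 _) (pow_nonneg (by linarith) _)

theorem Local.measurableSet {Λ : Finset V} {A : Set (V → Bool)} (hA : Local Λ A) :
    MeasurableSet[coordSigma (Λ : Set V)] A :=
  measurableSet_of_dependsOn Λ subset_rfl hA

theorem Local.prob_eq {Λ : Finset V} {A : Set (V → Bool)} (hA : Local Λ A) (p : I) :
    bernoulliProd (fun _ => p) A = ENNReal.ofReal (probPoly Λ A p) := by
  classical
  have hAU : A = ⋃ T ∈ Λ.powerset.filter fun T => indicatorConfig T ∈ A,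
      {ω : V → Bool | ∀ i ∈ Λ, ω i = indicatorConfig T i} := by
    ext ω
    simp only [Set.mem_iUnion, Finset.mem_filter, Finset.mem_powerset, exists_prop]
    constructor
    · intro hω
      have h : ∀ i ∈ Λ, ω i = indicatorConfig (Λ.filter fun i => ω i = true) i := by
        intro i hi
        simp [indicatorConfig, hi]
      exact ⟨_, ⟨Finset.filter_subset _ _, hA _ _ h hω⟩, h⟩
    · rintro ⟨T, ⟨-, hT⟩, h⟩
      exact hA _ _ (fun i hi => (h i hi).symm) hT
  have hp : (0 : ℝ) ≤ p := p.2.1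
  have hp' : (0 : ℝ) ≤ 1 - p := by linarith [p.2.2]
  conv_lhs => rw [hAU]
  rw [measure_biUnion_finset, probPoly, ENNReal.ofReal_sum_of_nonneg]
  · refine Finset.sum_congr rfl fun T hT => ?_
    obtain ⟨hT, -⟩ := Finset.mem_filter.1 hT
    rw [Finset.mem_powerset] at hT
    rw [bernoulliProd_forall_eq]
    have : ∀ i ∈ Λ, bernoulliMeasure true false p {indicatorConfig T i} =
        if i ∈ T then ENNReal.ofReal p else ENNReal.ofReal (1 - p) := by
      intro i _
      by_cases h : i ∈ T
      · rw [if_pos h, indicatorConfig_eq_true.2 h, bernoulliMeasure_true]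
      · rw [if_neg h, indicatorConfig_eq_false.2 h, bernoulliMeasure_false]
    rw [Finset.prod_congr rfl this, Finset.prod_ite, Finset.prod_const, Finset.prod_const,
      Finset.filter_mem_eq_inter, Finset.inter_eq_right.2 hT, ← Finset.sdiff_eq_filter,
      Finset.card_sdiff_of_subset hT, ENNReal.ofReal_mul (pow_nonneg hp _),
      ENNReal.ofReal_pow hp, ENNReal.ofReal_pow hp']
  · intro T _
    exact mul_nonneg (pow_nonneg hp _) (pow_nonneg hp' _)
  · intro T hT T' hT' hne
    refine Set.disjoint_left.2 fun ω h h' => hne ?_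
    have hT := Finset.mem_powerset.1 (Finset.mem_filter.1 hT).1
    have hT' := Finset.mem_powerset.1 (Finset.mem_filter.1 hT').1
    have key : ∀ i ∈ Λ, (i ∈ T ↔ i ∈ T') := fun i hi => by
      rw [← indicatorConfig_eq_true, ← indicatorConfig_eq_true, ← h i hi, ← h' i hi]
    ext i
    exact ⟨fun hi => (key i (hT hi)).1 hi, fun hi => (key i (hT' hi)).2 hi⟩
  · intro T _
    refine coordSigma_le _ _ (measurableSet_of_dependsOn Λ subset_rfl ?_)
    intro ω ω' h hω i hi
    rw [← h i hi]; exact hω i hi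

/-- `A` is stable under opening sites. -/
def Increasing (A : Set (V → Bool)) : Prop :=
  ∀ ω ω' : V → Bool, (∀ i, ω i = true → ω' i = true) → ω ∈ A → ω' ∈ A

open Classical in
/-- `y` is closed, `A` does not occur, and opening `y` makes it occur. -/
def closedPivotal (A : Set (V → Bool)) (y : V) : Set (V → Bool) :=
  {ω | ω y = false ∧ ω ∉ A ∧ Function.update ω y true ∈ A}

theorem Local.closedPivotal {Λ : Finset V} {A : Set (V → Bool)} (hA : Local Λ A) {y : V}
    (hy : y ∈ Λ) : Local Λ (closedPivotal A y) := by
  classical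
  rintro ω ω' h ⟨h1, h2, h3⟩
  refine ⟨by rw [← h y hy, h1], fun h' => h2 (hA _ _ (fun i hi => (h i hi).symm) h'),
    hA _ _ (fun i hi => ?_) h3⟩
  by_cases hiy : i = y
  · subst hiy; simp
  · simp [hiy, h i hi]

/-- One half of Russo's formula. -/
theorem exists_hasDerivAt_probPoly {Λ : Finset V} {A : Set (V → Bool)} (hA : Increasing A)
    {x : ℝ} (h0 : 0 ≤ x) (h1 : x ≤ 1) :
    ∃ D, HasDerivAt (probPoly Λ A) D x ∧ ∑ y ∈ Λ, probPoly Λ (closedPivotal A y) x ≤ D := by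
  classical
  -- The weight of a configuration with `k` open sites on `Λ` with one site deleted.
  let g : ℕ → ℝ := fun k => x ^ k * (1 - x) ^ (Λ.card - 1 - k)
  have hg : ∀ k, 0 ≤ g k := fun k => mul_nonneg (pow_nonneg h0 _) (pow_nonneg (by linarith) _)
  let F := Λ.powerset.filter fun T => indicatorConfig T ∈ A
  have hD : HasDerivAt (probPoly Λ A) (∑ T ∈ F,
      ((T.card : ℝ) * x ^ (T.card - 1) * (1 - x) ^ (Λ.card - T.card) +
        x ^ T.card * (((Λ.card - T.card : ℕ) : ℝ) * (1 - x) ^ (Λ.card - T.card - 1) * (-1)))) x := by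
    unfold probPoly
    refine HasDerivAt.fun_sum fun T _ => ?_
    exact (hasDerivAt_pow _ x).mul (((hasDerivAt_id x).const_sub 1).fun_pow _)
  refine ⟨_, hD, ?_⟩
  have hrw : ∀ T ∈ F, ((T.card : ℝ) * x ^ (T.card - 1) * (1 - x) ^ (Λ.card - T.card) +
        x ^ T.card * (((Λ.card - T.card : ℕ) : ℝ) * (1 - x) ^ (Λ.card - T.card - 1) * (-1))) =
      ∑ y ∈ Λ, if y ∈ T then g (T.card - 1) else - g T.card := by
    intro T hT
    have hT := Finset.mem_powerset.1 (Finset.mem_filter.1 hT).1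
    rw [Finset.sum_ite, Finset.sum_const, Finset.sum_const, Finset.filter_mem_eq_inter,
      Finset.inter_eq_right.2 hT, ← Finset.sdiff_eq_filter, Finset.card_sdiff_of_subset hT,
      nsmul_eq_mul, nsmul_eq_mul]
    have e1 : (T.card : ℝ) * x ^ (T.card - 1) * (1 - x) ^ (Λ.card - T.card) =
        T.card * g (T.card - 1) := by
      rcases Nat.eq_zero_or_pos T.card with h | h
      · simp [h]
      · simp only [g]
        rw [show Λ.card - 1 - (T.card - 1) = Λ.card - T.card by omega]
        ring
    have e2 : Λ.card - T.card - 1 = Λ.card - 1 - T.card := by omega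
    rw [e1, e2]
    simp only [g]
    ring
  rw [Finset.sum_congr rfl hrw, Finset.sum_comm]
  refine Finset.sum_le_sum fun y hy => ?_
  -- Erasing `y` makes the positive and negative terms comparable. By monotonicity they cancel
  -- except where opening `y` creates `A`.
  have hbij : ∑ T ∈ F with y ∈ T, g (T.card - 1) =
      ∑ T ∈ Λ.powerset with y ∉ T ∧ indicatorConfig (insert y T) ∈ A, g T.card := by
    refine Finset.sum_bij' (fun T _ => T.erase y) (fun T _ => insert y T) ?_ ?_ ?_ ?_ ?_
    · intro T hT
      simp only [F, Finset.mem_filter, Finset.mem_powerset] at hT ⊢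
      refine ⟨(Finset.erase_subset _ _).trans hT.1.1, Finset.notMem_erase _ _, ?_⟩
      rw [Finset.insert_erase hT.2]
      exact hT.1.2
    · intro T hT
      simp only [F, Finset.mem_filter, Finset.mem_powerset] at hT ⊢
      exact ⟨⟨Finset.insert_subset hy hT.1, hT.2.2⟩, Finset.mem_insert_self _ _⟩
    · intro T hT
      exact Finset.insert_erase (Finset.mem_filter.1 hT).2
    · intro T hT
      exact Finset.erase_insert (Finset.mem_filter.1 hT).2.1
    · intro T hT
      rw [Finset.card_erase_of_mem (Finset.mem_filter.1 hT).2]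
  rw [Finset.sum_ite, hbij, Finset.sum_neg_distrib]
  have hupd : ∀ T : Finset V, Function.update (indicatorConfig T) y true =
      indicatorConfig (insert y T) := by
    intro T
    ext i
    by_cases hi : i = y
    · subst hi; simp [indicatorConfig]
    · simp [indicatorConfig, hi]
  have hsplit : ∑ T ∈ Λ.powerset with y ∉ T ∧ indicatorConfig (insert y T) ∈ A, g T.card =
      ∑ T ∈ Λ.powerset with indicatorConfig T ∈ closedPivotal A y, g T.card +
        ∑ T ∈ F with y ∉ T, g T.card := by
    rw [← Finset.sum_union]
    · refine Finset.sum_congr ?_ fun _ _ => rfl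
      ext T
      simp only [F, Finset.mem_filter, Finset.mem_powerset, Finset.mem_union]
      constructor
      · rintro ⟨hT, hyT, hi⟩
        by_cases hTA : indicatorConfig T ∈ A
        · exact .inr ⟨⟨hT, hTA⟩, hyT⟩
        · refine .inl ⟨hT, indicatorConfig_eq_false.2 hyT, hTA, ?_⟩
          rw [hupd]; exact hi
      · rintro (⟨hT, h1, h2, h3⟩ | ⟨⟨hT, hTA⟩, hyT⟩)
        · rw [hupd] at h3
          exact ⟨hT, indicatorConfig_eq_false.1 h1, h3⟩
        · refine ⟨hT, hyT, hA _ _ (fun i hi => ?_) hTA⟩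
          rw [indicatorConfig_eq_true] at hi ⊢
          exact Finset.mem_insert_of_mem hi
    · refine Finset.disjoint_left.2 fun T h h' => ?_
      exact (Finset.mem_filter.1 h).2.2.1 (Finset.mem_filter.1 (Finset.mem_filter.1 h').1).2
  rw [hsplit, add_neg_cancel_right, probPoly]
  refine Finset.sum_le_sum fun T hT => ?_
  -- The true weight carries one more factor `1 - x`, that of the closed site `y`; dropping it is
  -- the only inequality.
  have h := pow_le_pow_of_le_one (a := 1 - x) (by linarith) (by linarith)
    (show Λ.card - 1 - T.card ≤ Λ.card - T.card by omega)
  exact mul_le_mul_of_nonneg_left h (pow_nonneg h0 _)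

theorem continuous_probPoly (Λ : Finset V) (A : Set (V → Bool)) : Continuous (probPoly Λ A) := by
  unfold probPoly; fun_prop

theorem differentiable_probPoly (Λ : Finset V) (A : Set (V → Bool)) :
    Differentiable ℝ (probPoly Λ A) := by
  unfold probPoly; fun_prop

theorem Increasing.prob_mono {Λ : Finset V} {A : Set (V → Bool)} (hA : Increasing A)
    (hL : Local Λ A) {p q : I} (hpq : p ≤ q) :
    bernoulliProd (fun _ => p) A ≤ bernoulliProd (fun _ => q) A := by
  rw [hL.prob_eq, hL.prob_eq]
  refine ENNReal.ofReal_le_ofReal ?_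
  have : MonotoneOn (probPoly Λ A) (Set.Icc 0 1) := by
    refine monotoneOn_of_deriv_nonneg (convex_Icc 0 1) (continuous_probPoly Λ A).continuousOn
      (differentiable_probPoly Λ A).differentiableOn fun x hx => ?_
    rw [interior_Icc] at hx
    obtain ⟨D, hD, hle⟩ := exists_hasDerivAt_probPoly (Λ := Λ) hA hx.1.le hx.2.le
    rw [hD.deriv]
    exact (Finset.sum_nonneg fun y _ => probPoly_nonneg Λ _ hx.1.le hx.2.le).trans hle
  exact this p.2 q.2 hpq

end Russo

/-! ### The Duminil-Copin–Tassion differential inequality. -/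

section Sharpness

variable {V : Type*} {G : SimpleGraph V} {Λ : Finset V} {D : Set V} {o : V}

/-- The cluster of `o` in `Λ` meets `D`. -/
def reachIn (G : SimpleGraph V) (Λ : Finset V) (D : Set V) (o : V) : Set (V → Bool) :=
  {ω | ∃ z ∈ D, Link G (openSet ω ∩ Λ) o z}

theorem increasing_reachIn : Increasing (reachIn G Λ D o) := by
  rintro ω ω' h ⟨z, hz, hl⟩
  exact ⟨z, hz, hl.mono fun u hu => ⟨h u hu.1, hu.2⟩⟩

theorem local_reachIn : Local Λ (reachIn G Λ D o) := by
  rintro ω ω' h ⟨z, hz, hl⟩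
  exact ⟨z, hz, hl.mono fun u hu => ⟨(h u hu.2).symm.trans hu.1, hu.2⟩⟩

/-- The sites of `Λ` that belong to `D`, or are linked to `D`, or have a neighbour linked to
`D`. -/
def explored (G : SimpleGraph V) (Λ : Finset V) (D : Set V) (ω : V → Bool) : Set V :=
  {y | y ∈ Λ ∧ (y ∈ D ∨ ω ∈ reachIn G Λ D y ∨ ∃ u, G.Adj y u ∧ ω ∈ reachIn G Λ D u)}

theorem reachIn_subset_explored {ω : V → Bool} {u : V} (h : ω ∈ reachIn G Λ D u) :
    u ∈ explored G Λ D ω := by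
  have h' := h
  obtain ⟨z, hz, hl⟩ := h'
  exact ⟨hl.left.2, .inr (.inl h)⟩

/-- The unexplored sites of `Λ` are exactly those of `S`. -/
def unexploredEvent (G : SimpleGraph V) (Λ S : Finset V) (D : Set V) : Set (V → Bool) :=
  {ω | ∀ y ∈ Λ, y ∈ S ↔ y ∉ explored G Λ D ω}

/-- Exploring from `D` queries only explored sites: `explored` contains `D` and the neighbours of
linked sites, so that the sites where the exploration stops are counted too. Hence the sites of `S`
remain fresh. -/
theorem measurableSet_unexploredEvent (S : Finset V) :
    MeasurableSet[coordSigma (↑S : Set V)ᶜ] (unexploredEvent G Λ S D) := by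
  classical
  refine measurableSet_of_dependsOn (Λ \ S) (fun x hx => ?_) ?_
  · rw [Finset.mem_coe, Finset.mem_sdiff] at hx
    exact hx.2
  · intro ω ω' h hω
    have hS : ∀ y ∈ explored G Λ D ω, ω y = ω' y := fun y hy =>
      h y (Finset.mem_sdiff.2 ⟨hy.1, fun hyS => (hω y hy.1).1 hyS hy⟩)
    have key : ∀ u, ω ∈ reachIn G Λ D u ↔ ω' ∈ reachIn G Λ D u := by
      intro u
      constructor
      · rintro ⟨z, hz, hl⟩
        refine ⟨z, hz, Link.symm (hl.symm.induct (fun hzO => .refl ⟨?_, hzO.2⟩)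
          fun a b hza hab hb ih => ih.tail hab ⟨?_, hb.2⟩)⟩
        · exact (hS z ⟨hzO.2, .inl hz⟩).symm.trans hzO.1
        · exact (hS b (reachIn_subset_explored ⟨z, hz, (hza.tail hab hb).symm⟩)).symm.trans hb.1
      · rintro ⟨z, hz, hl⟩
        refine ⟨z, hz, Link.symm (hl.symm.induct (fun hzO => .refl ⟨?_, hzO.2⟩)
          fun a b hza hab hb ih => ih.tail hab ⟨?_, hb.2⟩)⟩
        · exact (hS z ⟨hzO.2, .inl hz⟩).trans hzO.1
        · exact (hS b ⟨hb.2, .inr (.inr ⟨a, hab.symm, z, hz, ih.symm⟩)⟩).trans hb.1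
    have hE : explored G Λ D ω' = explored G Λ D ω := by
      ext y
      simp only [explored, Set.mem_ofPred_eq, key]
    intro y hy
    rw [hE]
    exact hω y hy

/-- An exit site `y` of the cluster of `o` in `S` is explored but not linked to `D`, otherwise its
neighbour in `S` would be explored. So `y` is closed, and opening it joins `o` to `D`. -/
theorem closedPivotal_of_unexplored (hD : ∀ z ∈ Λ, ∀ w, w ∉ Λ → G.Adj z w → z ∈ D)
    {S : Finset V} (hS : S ⊆ Λ) (ho : o ∈ S) {ω : V → Bool}
    (hω : ω ∈ unexploredEvent G Λ S D) {y : V} (hy : y ∉ S)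
    (hx : ∃ x ∈ S, G.Adj x y ∧ Link G (openSet ω ∩ S) o x) :
    y ∈ Λ ∧ ω ∈ closedPivotal (reachIn G Λ D o) y := by
  classical
  obtain ⟨x, hxS, hxy, hl⟩ := hx
  have hSE : ∀ u ∈ S, u ∉ explored G Λ D ω := fun u hu => (hω u (hS hu)).1 hu
  have hyΛ : y ∈ Λ := by
    by_contra hyΛ
    refine hSE x hxS ⟨hS hxS, .inl ?_⟩
    exact hD x (hS hxS) y hyΛ hxy
  have hyE : y ∈ explored G Λ D ω := by
    by_contra h
    exact hy ((hω y hyΛ).2 h)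
  have hyU : ω ∉ reachIn G Λ D y := fun h => by
    refine hSE x hxS ⟨hS hxS, .inr (.inr ⟨y, hxy, ?_⟩)⟩
    exact h
  have hyc : ω y = false := by
    by_contra h
    rw [Bool.not_eq_false] at h
    have hyO : y ∈ openSet ω ∩ Λ := ⟨h, hyΛ⟩
    rcases hyE.2 with h' | h' | ⟨u, hyu, z, hz, hl'⟩
    · exact hyU ⟨y, h', .refl hyO⟩
    · exact hyU h'
    · exact hyU ⟨z, hz, (Link.of_adj hyO hl'.left hyu).trans hl'⟩
  refine ⟨hyΛ, hyc, fun h => hSE o ho (reachIn_subset_explored h), ?_⟩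
  have hsub : openSet ω ⊆ openSet (Function.update ω y true) := by
    intro u hu
    by_cases h : u = y
    · subst h; simp [openSet]
    · simpa [openSet, h] using hu
  have hy' : y ∈ openSet (Function.update ω y true) ∩ Λ := ⟨by simp [openSet], hyΛ⟩
  have hoy : Link G (openSet (Function.update ω y true) ∩ Λ) o y :=
    (hl.mono (O' := openSet (Function.update ω y true) ∩ Λ)
      fun u hu => ⟨hsub hu.1, hS hu.2⟩).tail hxy hy'
  rcases hyE.2 with h' | h' | ⟨u, hyu, z, hz, hl'⟩
  · exact ⟨y, h', hoy⟩
  · exact absurd h' hyU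
  · have hl'' := hl'.mono (O' := openSet (Function.update ω y true) ∩ Λ)
      fun u hu => ⟨hsub hu.1, hu.2⟩
    exact ⟨z, hz, (hoy.tail hyu hl''.left).trans hl''⟩

/-- Given that the unexplored set is `S ∋ o`, the expected number of exit sites from `S` is
`exitMean`, hence at least one, and every exit site is closed pivotal. -/
theorem prob_unexplored_le [Countable V] (hD : ∀ z ∈ Λ, ∀ w, w ∉ Λ → G.Adj z w → z ∈ D) {p : I}
    (hp : ∀ S : Finset V, o ∈ S → 1 ≤ exitMean G p o S) :
    bernoulliProd (fun _ => p) {ω : V → Bool | o ∈ Λ ∧ o ∉ explored G Λ D ω} ≤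
      ∑ y ∈ Λ, bernoulliProd (fun _ => p) (closedPivotal (reachIn G Λ D o) y) := by
  classical
  set μ := bernoulliProd (fun _ : V => p)
  let 𝒮 := Λ.powerset.filter fun S => o ∈ S
  have h𝒮 : ∀ S ∈ 𝒮, S ⊆ Λ ∧ o ∈ S := fun S hS => by simpa [𝒮] using hS
  let H : Finset V → V → Set (V → Bool) := fun S y =>
    {ω | y ∉ (S : Set V) ∧ ∃ x ∈ (S : Set V), G.Adj x y ∧ Link G (openSet ω ∩ S) o x}
  have hHm : ∀ (S : Finset V) (y : V), MeasurableSet[coordSigma (S : Set V)] (H S y) := by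
    intro S y
    convert measurableSet_exists_link G (S : Set V)
      (fun a x => a = o ∧ y ∉ (S : Set V) ∧ x ∈ (S : Set V) ∧ G.Adj x y) using 1
    ext ω
    constructor
    · rintro ⟨h1, x, h2, h3, h4⟩
      exact ⟨o, x, ⟨rfl, h1, h2, h3⟩, h4⟩
    · rintro ⟨_, x, ⟨rfl, h1, h2, h3⟩, h4⟩
      exact ⟨h1, x, h2, h3, h4⟩
  have hUm : ∀ S : Finset V, MeasurableSet[coordSigma (S : Set V)ᶜ] (unexploredEvent G Λ S D) :=
    measurableSet_unexploredEvent
  have hdisj : ∀ S ∈ 𝒮, ∀ S' ∈ 𝒮, S ≠ S' →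
      Disjoint (unexploredEvent G Λ S D) (unexploredEvent G Λ S' D) := by
    intro S hS S' hS' hne
    refine Set.disjoint_left.2 fun ω h h' => hne ?_
    ext y
    constructor
    · intro hy
      have hyΛ := (h𝒮 S hS).1 hy
      exact (h' y hyΛ).2 ((h y hyΛ).1 hy)
    · intro hy
      have hyΛ := (h𝒮 S' hS').1 hy
      exact (h y hyΛ).2 ((h' y hyΛ).1 hy)
  have hcover : {ω : V → Bool | o ∈ Λ ∧ o ∉ explored G Λ D ω} ⊆
      ⋃ S ∈ 𝒮, unexploredEvent G Λ S D := by
    rintro ω ⟨hoΛ, ho⟩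
    simp only [Set.mem_iUnion]
    refine ⟨Λ.filter fun y => y ∉ explored G Λ D ω, ?_, ?_⟩
    · simp [𝒮, hoΛ, ho]
    · intro y hy
      simp [hy]
  have hterm : ∀ S ∈ 𝒮, μ (unexploredEvent G Λ S D) ≤
      ∑ y ∈ Λ, μ (unexploredEvent G Λ S D ∩ H S y) := by
    intro S hS
    obtain ⟨hSΛ, hoS⟩ := h𝒮 S hS
    -- A set `S` that occurs as unexplored set avoids `D`, so all its exits stay in `Λ` and the
    -- series defining `exitMean` is a sum over `Λ`.
    rcases (unexploredEvent G Λ S D).eq_empty_or_nonempty with he | ⟨ω₀, hω₀⟩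
    · simp [he]
    have hzero : ∀ y ∉ Λ, μ (H S y) = 0 := by
      intro y hy
      have : H S y = ∅ := by
        ext ω
        refine ⟨?_, fun h => h.elim⟩
        rintro ⟨-, x, hx, hxy, -⟩
        exact (hω₀ x (hSΛ hx)).1 hx ⟨hSΛ hx, .inl (hD x (hSΛ hx) y hy hxy)⟩
      rw [this, measure_empty]
    have h1 : exitMean G p o S = ∑ y ∈ Λ, μ (H S y) := tsum_eq_sum fun y hy => hzero y hy
    calc μ (unexploredEvent G Λ S D) = μ (unexploredEvent G Λ S D) * 1 := (mul_one _).symm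
      _ ≤ μ (unexploredEvent G Λ S D) * ∑ y ∈ Λ, μ (H S y) :=
          mul_le_mul_right (h1 ▸ hp S hoS) _
      _ = ∑ y ∈ Λ, μ (unexploredEvent G Λ S D ∩ H S y) := by
          rw [Finset.mul_sum]
          refine Finset.sum_congr rfl fun y _ => ?_
          exact (bernoulliProd_inter _ disjoint_compl_left (hUm S) (hHm S y)).symm
  calc μ {ω : V → Bool | o ∈ Λ ∧ o ∉ explored G Λ D ω}
      ≤ μ (⋃ S ∈ 𝒮, unexploredEvent G Λ S D) := measure_mono hcover
    _ ≤ ∑ S ∈ 𝒮, μ (unexploredEvent G Λ S D) := measure_biUnion_finset_le _ _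
    _ ≤ ∑ S ∈ 𝒮, ∑ y ∈ Λ, μ (unexploredEvent G Λ S D ∩ H S y) := Finset.sum_le_sum hterm
    _ = ∑ y ∈ Λ, ∑ S ∈ 𝒮, μ (unexploredEvent G Λ S D ∩ H S y) := Finset.sum_comm
    _ ≤ ∑ y ∈ Λ, μ (closedPivotal (reachIn G Λ D o) y) := by
      refine Finset.sum_le_sum fun y _ => ?_
      rw [← measure_biUnion_finset]
      · refine measure_mono ?_
        intro ω hω
        simp only [Set.mem_iUnion] at hω
        obtain ⟨S, hS, hω, hy, hx⟩ := hω
        exact (closedPivotal_of_unexplored hD (h𝒮 S hS).1 (h𝒮 S hS).2 hω hy hx).2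
      · intro S hS S' hS' hne
        exact (hdisj S hS S' hS' hne).mono Set.inter_subset_left Set.inter_subset_left
      · intro S _
        exact (coordSigma_le _ _ (hUm S)).inter (coordSigma_le _ _ (hHm S y))

/-- An open `o` that is explored is linked to `D`; otherwise it is unexplored and
`prob_unexplored_le` applies. -/
theorem le_prob_add_sum_closedPivotal [Countable V]
    (hD : ∀ z ∈ Λ, ∀ w, w ∉ Λ → G.Adj z w → z ∈ D) (ho : o ∈ Λ) {p : I}
    (hp : ∀ S : Finset V, o ∈ S → 1 ≤ exitMean G p o S) :
    (p : ℝ) ≤ probPoly Λ (reachIn G Λ D o) p +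
      ∑ y ∈ Λ, probPoly Λ (closedPivotal (reachIn G Λ D o) y) p := by
  have h1 := prob_unexplored_le (o := o) hD hp
  rw [Finset.sum_congr rfl fun y hy => (local_reachIn.closedPivotal hy).prob_eq p,
    ← ENNReal.ofReal_sum_of_nonneg fun y _ => probPoly_nonneg _ _ p.2.1 p.2.2] at h1
  have h2 : {ω : V → Bool | ω o = true} ⊆
      reachIn G Λ D o ∪ {ω : V → Bool | o ∈ Λ ∧ o ∉ explored G Λ D ω} := by
    intro ω hω
    by_cases h : o ∈ explored G Λ D ω
    · left
      have hoO : o ∈ openSet ω ∩ Λ := ⟨hω, ho⟩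
      rcases h.2 with h' | h' | ⟨u, hou, z, hz, hl⟩
      · exact ⟨o, h', .refl hoO⟩
      · exact h'
      · exact ⟨z, hz, (Link.of_adj hoO hl.left hou).trans hl⟩
    · exact .inr ⟨ho, h⟩
  have h3 := (measure_mono (μ := bernoulliProd fun _ => p) h2).trans (measure_union_le _ _)
  rw [bernoulliProd_eval, local_reachIn.prob_eq] at h3
  have h4 := h3.trans (add_le_add_right h1 _)
  have hn : ∀ A, 0 ≤ probPoly Λ A p := fun A => probPoly_nonneg _ _ p.2.1 p.2.2
  rw [← ENNReal.ofReal_add (hn _) (Finset.sum_nonneg fun y _ => hn _)] at h4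
  exact (ENNReal.ofReal_le_ofReal_iff (add_nonneg (hn _) (Finset.sum_nonneg fun y _ => hn _))).1 h4

theorem exitMean_mono [Countable V] (S : Finset V) {p q : I} (hpq : p ≤ q) :
    exitMean G p o S ≤ exitMean G q o S := by
  refine ENNReal.tsum_le_tsum fun y => Increasing.prob_mono (Λ := S) ?_ ?_ hpq
  · rintro ω ω' h ⟨hy, x, hx, hxy, hl⟩
    exact ⟨hy, x, hx, hxy, hl.mono fun u hu => ⟨h u hu.1, hu.2⟩⟩
  · rintro ω ω' h ⟨hy, x, hx, hxy, hl⟩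
    exact ⟨hy, x, hx, hxy, hl.mono fun u hu => ⟨(h u hu.2).symm.trans hu.1, hu.2⟩⟩

/-- The Duminil-Copin–Tassion differential inequality, integrated. -/
theorem le_prob_reachIn [Countable V] (hD : ∀ z ∈ Λ, ∀ w, w ∉ Λ → G.Adj z w → z ∈ D)
    (ho : o ∈ Λ) {p q : I} (hpq : p ≤ q)
    (hp : ∀ S : Finset V, o ∈ S → 1 ≤ exitMean G p o S) :
    ENNReal.ofReal ((q - p) * (p / 2)) ≤ bernoulliProd (fun _ => q) (reachIn G Λ D o) := by
  rw [local_reachIn.prob_eq]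
  refine ENNReal.ofReal_le_ofReal ?_
  set F := probPoly Λ (reachIn G Λ D o)
  have hp0 : (0 : ℝ) ≤ p := p.2.1
  have hq1 : (q : ℝ) ≤ 1 := q.2.2
  have hpq' : (p : ℝ) ≤ q := hpq
  -- If `F q` were smaller, monotonicity would keep `F` below `p / 2` on `[p, q]`, so `F' ≥ x - F ≥
  -- p / 2` there, and integration gives the bound after all.
  by_contra! hcon
  have hder : ∀ x ∈ Set.Icc (p : ℝ) q, ∃ d, HasDerivAt F d x ∧ 0 ≤ d ∧ x - F x ≤ d := by
    intro x hx
    have hx0 : 0 ≤ x := hp0.trans hx.1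
    have hx1 : x ≤ 1 := hx.2.trans hq1
    obtain ⟨d, hd, hle⟩ := exists_hasDerivAt_probPoly (Λ := Λ)
      (increasing_reachIn (G := G) (Λ := Λ) (D := D) (o := o)) hx0 hx1
    have h := le_prob_add_sum_closedPivotal hD ho (p := ⟨x, hx0, hx1⟩)
      fun S hS => (hp S hS).trans (exitMean_mono S hx.1)
    refine ⟨d, hd, (Finset.sum_nonneg fun y _ => probPoly_nonneg _ _ hx0 hx1).trans hle, ?_⟩
    have h' : x ≤ F x + ∑ y ∈ Λ, probPoly Λ (closedPivotal (reachIn G Λ D o) y) x := h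
    linarith
  have hcont : Continuous F := continuous_probPoly _ _
  have hmono : MonotoneOn F (Set.Icc (p : ℝ) q) := by
    refine monotoneOn_of_deriv_nonneg (convex_Icc _ _) hcont.continuousOn
      (differentiable_probPoly _ _).differentiableOn fun x hx => ?_
    obtain ⟨d, hd, h, -⟩ := hder x (interior_subset hx)
    rwa [hd.deriv]
  have hsmall : (q - p) * ((p : ℝ) / 2) ≤ p / 2 := by nlinarith
  have hmvt := Convex.mul_sub_le_image_sub_of_le_deriv (convex_Icc (p : ℝ) q) hcont.continuousOn
    (differentiable_probPoly _ _).differentiableOn (C := (p : ℝ) / 2) (fun x hx => by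
      obtain ⟨d, hd, -, h⟩ := hder x (interior_subset hx)
      have h2 := hmono (interior_subset hx) (Set.right_mem_Icc.2 hpq') (interior_subset hx).2
      have h3 := (interior_subset hx).1
      rw [hd.deriv]
      linarith) p (Set.left_mem_Icc.2 hpq') q (Set.right_mem_Icc.2 hpq') hpq'
  have hF0 : 0 ≤ F p := probPoly_nonneg _ _ p.2.1 p.2.2
  change F q < _ at hcon
  have hmvt' : (p : ℝ) / 2 * (q - p) ≤ F q - F p := hmvt
  nlinarith

end Sharpness

/-! ### Exponential decay below the critical point. -/

section Critical

variable {m : ℕ}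

theorem connInfty_prob_eq_zero {p : I} (h : (p : ℝ) < criticalProb m) :
    bernoulliProd (fun _ : Fin m → ℤ => p) (connInfty m) = 0 := by
  by_contra hne
  refine notMem_of_lt_csInf h ⟨0, ?_⟩ ⟨p, rfl, pos_iff_ne_zero.2 hne⟩
  rintro x ⟨q, rfl, -⟩
  exact q.2.1

theorem criticalProb_le_one (m : ℕ) : criticalProb m ≤ 1 := by
  unfold criticalProb
  set S := {p : ℝ | ∃ q : I, (q : ℝ) = p ∧ 0 < bernoulliField (Fin m → ℤ) q (connInfty m)}
  rcases S.eq_empty_or_nonempty with h | ⟨x, hx⟩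
  -- In dimension `0` no infinite path exists, and the infimum takes its default value `0`.
  · rw [h, Real.sInf_empty]; norm_num
  · refine (csInf_le ⟨0, ?_⟩ hx).trans ?_
    · rintro x ⟨q, rfl, -⟩
      exact q.2.1
    · obtain ⟨q, rfl, -⟩ := hx
      exact q.2.2

theorem exists_exitMean_lt_one {p : I} (h : (p : ℝ) < criticalProb m) :
    ∃ S : Finset (Fin m → ℤ), 0 ∈ S ∧ exitMean (lattice m) p 0 S < 1 := by
  by_contra! hcon
  obtain ⟨r, hpr, hrc⟩ := exists_between h
  have hr1 : r ≤ 1 := hrc.le.trans (criticalProb_le_one m)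
  let q : I := ⟨r, p.2.1.trans hpr.le, hr1⟩
  have hpq : p ≤ q := hpr.le
  -- At `p = 0` the set `{0}` already has exit mean `0`. Positivity is needed for the lower bound
  -- `c` to be nontrivial.
  have hp0 : (0 : ℝ) < p := by
    rcases p.2.1.lt_or_eq with h0 | h0
    · exact h0
    exfalso
    have h1 := hcon {0} (by simp)
    have : exitMean (lattice m) p 0 ({0} : Finset (Fin m → ℤ)) = 0 := by
      refine ENNReal.tsum_eq_zero.2 fun y => measure_mono_null
        (t := {ω : (Fin m → ℤ) → Bool | ω 0 = true}) ?_ ?_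
      · rintro ω ⟨-, x, -, -, hl⟩
        exact hl.left.1
      · rw [bernoulliProd_eval, ← h0, ENNReal.ofReal_zero]
    rw [this] at h1
    simp at h1
  set c := ENNReal.ofReal ((q - p) * (p / 2))
  have hc : 0 < c := by
    refine ENNReal.ofReal_pos.2 (mul_pos ?_ (by linarith))
    exact sub_pos.2 hpr
  have hle : ∀ n, c ≤ bernoulliProd (fun _ => q) (reach (lattice m) 0 (far m n)) := by
    intro n
    have hmem : ∀ v, v ∈ (finite_box m n).toFinset ↔ v ∈ box m n := fun v => by simp
    refine (le_prob_reachIn (G := lattice m) (Λ := (finite_box m n).toFinset) (D := far m n)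
      (o := 0) ?_ ?_ hpq hcon).trans (measure_mono ?_)
    · intro z hz w hw hzw
      rw [hmem, not_mem_box_iff] at hw
      obtain ⟨k, hk⟩ := hw
      have h1 := lattice_adj_coord hzw k
      have h2 := abs_sub_abs_le_abs_sub (w k) (z k)
      rw [abs_sub_comm] at h1
      refine ⟨k, ?_⟩
      push_cast at hk
      linarith
    · rw [hmem]
      intro i
      simp
    · rintro ω ⟨z, hz, hl⟩
      exact ⟨z, hz, hl.mono Set.inter_subset_left⟩
  have h0 := connInfty_prob_eq_zero (p := q) hrc
  rw [connInfty_eq, Antitone.measure_iInter (fun a b hab => reach_mono (far_anti hab))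
    (fun n => (measurableSet_reach _ _ _).nullMeasurableSet) ⟨0, measure_ne_top _ _⟩] at h0
  exact absurd (h0 ▸ le_iInf hle) (not_le.2 hc)

/-- Below the critical point the cluster of the origin has an exponentially small tail. -/
theorem exists_exponential_decay {p : I} (h : (p : ℝ) < criticalProb m) :
    ∃ r : ENNReal, r < 1 ∧ ∃ L : ℕ, 0 < L ∧ ∀ k : ℕ,
      bernoulliProd (fun _ => p) (reach (lattice m) 0 (far m (k * L))) ≤ r ^ k := by
  obtain ⟨S, h0, hS⟩ := exists_exitMean_lt_one h
  refine ⟨_, hS, ∑ v ∈ S, ∑ k, (v k).natAbs + 1, by omega, fun k =>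
    reach_far_le_pow p h0 (fun v hv i => ?_) k⟩
  have h1 : (v i).natAbs ≤ ∑ k, (v k).natAbs :=
    Finset.single_le_sum (f := fun k => (v k).natAbs) (fun _ _ => Nat.zero_le _)
      (Finset.mem_univ i)
  have h2 : ∑ k, (v k).natAbs ≤ ∑ v ∈ S, ∑ k, (v k).natAbs :=
    Finset.single_le_sum (f := fun v : Fin m → ℤ => ∑ k, (v k).natAbs)
      (fun _ _ => Nat.zero_le _) hv
  rw [Int.abs_eq_natAbs]
  exact_mod_cast Nat.lt_succ_of_le (h1.trans h2)

end Critical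

/-! ### Hierarchical renormalisation of a planar field with finite-range dependence. -/

section Hierarchy

variable {ι : Type*}

/-- The pairs of positions in a `5 × 5` block whose first or second coordinates differ by at
least `2`. -/
noncomputable def separatedPairs : Finset ((ℤ × ℤ) × (ℤ × ℤ)) :=
  ((Finset.Ico 0 5 ×ˢ Finset.Ico 0 5) ×ˢ (Finset.Ico 0 5 ×ˢ Finset.Ico 0 5)).filter
    fun t => t.1.1 + 2 ≤ t.2.1 ∨ t.1.2 + 2 ≤ t.2.2

theorem mem_separatedPairs {i j i' j' : ℤ} :
    ((i, j), (i', j')) ∈ separatedPairs ↔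
      (((0 ≤ i ∧ i < 5) ∧ (0 ≤ j ∧ j < 5)) ∧ ((0 ≤ i' ∧ i' < 5) ∧ (0 ≤ j' ∧ j' < 5))) ∧
        (i + 2 ≤ i' ∨ j + 2 ≤ j') := by
  simp [separatedPairs]

theorem card_separatedPairs_le : separatedPairs.card ≤ 625 :=
  (Finset.card_filter_le _ _).trans (by simp)

/-- A block of level `n + 1` consists of `5 × 5` blocks of level `n`; it is bad when two separated
ones among these are bad. -/
def bad {Ω : Type*} (B : ℤ → ℤ → Set Ω) : ℕ → ℤ → ℤ → Set Ω
  | 0 => B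
  | n + 1 => fun a b => ⋃ t ∈ separatedPairs,
      bad B n (5 * a + t.1.1) (5 * b + t.1.2) ∩ bad B n (5 * a + t.2.1) (5 * b + t.2.2)

/-- The coordinates on which a block of level `n` depends. -/
def blockSupport (R : ℤ → ℤ → Set ι) : ℕ → ℤ → ℤ → Set ι
  | 0 => R
  | n + 1 => fun a b => ⋃ (i : ℤ) (j : ℤ) (_ : (0 ≤ i ∧ i < 5) ∧ (0 ≤ j ∧ j < 5)),
      blockSupport R n (5 * a + i) (5 * b + j)

theorem measurableSet_bad {B : ℤ → ℤ → Set (ι → Bool)} {R : ℤ → ℤ → Set ι}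
    (hB : ∀ a b, MeasurableSet[coordSigma (R a b)] (B a b)) (n : ℕ) :
    ∀ a b, MeasurableSet[coordSigma (blockSupport R n a b)] (bad B n a b) := by
  induction n with
  | zero => exact hB
  | succ n ih =>
    intro a b
    have hsub : ∀ i j : ℤ, ((0 ≤ i ∧ i < 5) ∧ (0 ≤ j ∧ j < 5)) →
        blockSupport R n (5 * a + i) (5 * b + j) ⊆ blockSupport R (n + 1) a b := by
      intro i j h x hx
      simp only [blockSupport, Set.mem_iUnion]
      exact ⟨i, j, h, hx⟩
    refine Finset.measurableSet_biUnion _ ?_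
    rintro ⟨⟨i, j⟩, i', j'⟩ ht
    rw [mem_separatedPairs] at ht
    exact (coordSigma_mono (hsub _ _ ht.1.1) _ (ih _ _)).inter
      (coordSigma_mono (hsub _ _ ht.1.2) _ (ih _ _))

/-- Passing to sub-blocks turns a gap of `2` into one of at least `10 - 4 = 6`, so range one
persists at every level. -/
theorem disjoint_blockSupport {R : ℤ → ℤ → Set ι}
    (hR : ∀ a b a' b' : ℤ, 2 ≤ |a - a'| ∨ 2 ≤ |b - b'| → Disjoint (R a b) (R a' b')) (n : ℕ) :
    ∀ a b a' b' : ℤ, 2 ≤ |a - a'| ∨ 2 ≤ |b - b'| →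
      Disjoint (blockSupport R n a b) (blockSupport R n a' b') := by
  induction n with
  | zero => exact hR
  | succ n ih =>
    intro a b a' b' h
    refine Set.disjoint_left.2 fun x hx hx' => ?_
    simp only [blockSupport, Set.mem_iUnion] at hx hx'
    obtain ⟨i, j, hij, hx⟩ := hx
    obtain ⟨i', j', hij', hx'⟩ := hx'
    refine Set.disjoint_left.1 (ih _ _ _ _ ?_) hx hx'
    simp only [le_abs] at h ⊢
    omega

/-- Independence of separated sub-blocks gives the recursion `u ↦ 625 u²`, which halves any value up
to `1 / 1250`. -/
theorem prob_bad_le {q : ι → I} {B : ℤ → ℤ → Set (ι → Bool)} {R : ℤ → ℤ → Set ι}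
    (hB : ∀ a b, MeasurableSet[coordSigma (R a b)] (B a b))
    (hR : ∀ a b a' b' : ℤ, 2 ≤ |a - a'| ∨ 2 ≤ |b - b'| → Disjoint (R a b) (R a' b'))
    (h0 : ∀ a b, bernoulliProd q (B a b) ≤ 625⁻¹ * 2⁻¹) (n : ℕ) :
    ∀ a b, bernoulliProd q (bad B n a b) ≤ 625⁻¹ * 2⁻¹ ^ (n + 1) := by
  induction n with
  | zero => simpa [bad] using h0
  | succ n ih =>
    intro a b
    have hpair : ∀ t ∈ separatedPairs, bernoulliProd q
        (bad B n (5 * a + t.1.1) (5 * b + t.1.2) ∩ bad B n (5 * a + t.2.1) (5 * b + t.2.2)) ≤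
        (625⁻¹ * 2⁻¹ ^ (n + 1)) * (625⁻¹ * 2⁻¹ ^ (n + 1)) := by
      rintro ⟨⟨i, j⟩, i', j'⟩ ht
      rw [mem_separatedPairs] at ht
      rw [bernoulliProd_inter q (disjoint_blockSupport hR n _ _ _ _ ?_)
        (measurableSet_bad hB n _ _) (measurableSet_bad hB n _ _)]
      · exact mul_le_mul' (ih _ _) (ih _ _)
      · simp only [le_abs]
        omega
    calc bernoulliProd q (bad B (n + 1) a b)
        ≤ ∑ t ∈ separatedPairs, bernoulliProd q (bad B n (5 * a + t.1.1) (5 * b + t.1.2) ∩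
            bad B n (5 * a + t.2.1) (5 * b + t.2.2)) := measure_biUnion_finset_le _ _
      _ ≤ ∑ t ∈ separatedPairs, (625⁻¹ * 2⁻¹ ^ (n + 1)) * (625⁻¹ * 2⁻¹ ^ (n + 1)) :=
          Finset.sum_le_sum hpair
      _ ≤ 625 * ((625⁻¹ * 2⁻¹ ^ (n + 1)) * (625⁻¹ * 2⁻¹ ^ (n + 1))) := by
          rw [Finset.sum_const, nsmul_eq_mul]
          gcongr
          exact_mod_cast card_separatedPairs_le
      _ = (625 * 625⁻¹) * (625⁻¹ * (2⁻¹ ^ (n + 1) * 2⁻¹ ^ (n + 1))) := by ring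
      _ ≤ 625⁻¹ * 2⁻¹ ^ (n + 1 + 1) := by
          rw [ENNReal.mul_inv_cancel (by norm_num) (by norm_num), one_mul, pow_succ _ (n + 1)]
          gcongr
          calc (2⁻¹ : ENNReal) ^ (n + 1) ≤ 2⁻¹ ^ 1 :=
                pow_le_pow_right_of_le_one' (by simp) (by omega)
            _ = 2⁻¹ := pow_one _

/-- The union bound over five blocks at every level sums to `5 / 625 < 1`. -/
theorem prob_forall_good_pos {q : ι → I} {B : ℤ → ℤ → Set (ι → Bool)} {R : ℤ → ℤ → Set ι}
    (hB : ∀ a b, MeasurableSet[coordSigma (R a b)] (B a b))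
    (hR : ∀ a b a' b' : ℤ, 2 ≤ |a - a'| ∨ 2 ≤ |b - b'| → Disjoint (R a b) (R a' b'))
    (h0 : ∀ a b, bernoulliProd q (B a b) ≤ 625⁻¹ * 2⁻¹) :
    0 < bernoulliProd q {ω | ∀ n, ∀ j : ℤ, 0 ≤ j → j < 5 → ω ∉ bad B n 0 j} := by
  have h1 : bernoulliProd q (⋃ n, ⋃ j ∈ Finset.Ico (0 : ℤ) 5, bad B n 0 j) < 1 := by
    calc bernoulliProd q (⋃ n, ⋃ j ∈ Finset.Ico (0 : ℤ) 5, bad B n 0 j)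
        ≤ ∑' n, bernoulliProd q (⋃ j ∈ Finset.Ico (0 : ℤ) 5, bad B n 0 j) := measure_iUnion_le _
      _ ≤ ∑' n : ℕ, (5 * 625⁻¹) * 2⁻¹ ^ (n + 1) := by
          refine ENNReal.tsum_le_tsum fun n => (measure_biUnion_finset_le _ _).trans ?_
          refine (Finset.sum_le_sum fun j _ => prob_bad_le hB hR h0 n 0 j).trans ?_
          rw [Finset.sum_const, nsmul_eq_mul, mul_assoc]
          simp
      _ = 5 * 625⁻¹ := by
          rw [ENNReal.tsum_mul_left, ENNReal.tsum_geometric_add_one, ENNReal.one_sub_inv_two,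
            inv_inv, ENNReal.inv_mul_cancel (by norm_num) (by norm_num), mul_one]
      _ < 1 := by
          rw [← div_eq_mul_inv]
          exact ENNReal.div_lt_of_lt_mul (by norm_num)
  have h2 : {ω | ∀ n, ∀ j : ℤ, 0 ≤ j → j < 5 → ω ∉ bad B n 0 j} =
      (⋃ n, ⋃ j ∈ Finset.Ico (0 : ℤ) 5, bad B n 0 j)ᶜ := by
    ext ω
    simp only [Set.mem_ofPred_eq, Set.mem_compl_iff, Set.mem_iUnion, Finset.mem_Ico, not_exists]
    exact ⟨fun h n j hj => h n j hj.1 hj.2, fun h n j hj hj5 => h n j ⟨hj, hj5⟩⟩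
  rw [h2, prob_compl_eq_one_sub]
  · exact tsub_pos_of_lt h1
  · exact MeasurableSet.iUnion fun n => Finset.measurableSet_biUnion _ fun j _ =>
      coordSigma_le _ _ (measurableSet_bad hB n _ _)

/-- The part of the block `(a, b)` of level `n` that is made of the sub-blocks in clean rows and
clean columns. -/
def backbone {Ω : Type*} (B : ℤ → ℤ → Set Ω) (ω : Ω) : ℕ → ℤ → ℤ → Set (ℤ × ℤ)
  | 0 => fun a b => {(a, b)}
  | n + 1 => fun a b => {z | ∃ i j : ℤ, ((0 ≤ i ∧ i < 5) ∧ (0 ≤ j ∧ j < 5)) ∧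
      z ∈ backbone B ω n (5 * a + i) (5 * b + j) ∧
      ((∀ k : ℤ, 0 ≤ k → k < 5 → ω ∉ bad B n (5 * a + i) (5 * b + k)) ∨
        ∀ k : ℤ, 0 ≤ k → k < 5 → ω ∉ bad B n (5 * a + k) (5 * b + j))}

theorem le_of_mem_backbone {Ω : Type*} {B : ℤ → ℤ → Set Ω} {ω : Ω} (n : ℕ) :
    ∀ a b z, z ∈ backbone B ω n a b → 5 ^ n * b ≤ z.2 := by
  induction n with
  | zero =>
    rintro a b z rfl
    simp
  | succ n ih =>
    rintro a b z ⟨i, j, hij, hz, -⟩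
    have := ih _ _ _ hz
    have h5 : (0 : ℤ) ≤ 5 ^ n * j := mul_nonneg (by positivity) hij.2.1
    calc (5 : ℤ) ^ (n + 1) * b ≤ 5 ^ n * (5 * b + j) := by rw [pow_succ]; linarith
      _ ≤ z.2 := this

/-- Two families of forbidden positions, each of diameter at most one, leave a common free
position. -/
theorem exists_common_free {P Q : ℤ → Prop}
    (hP : ∀ i i', 0 ≤ i → i < 5 → 0 ≤ i' → i' < 5 → i + 2 ≤ i' → P i ∨ P i')
    (hQ : ∀ i i', 0 ≤ i → i < 5 → 0 ≤ i' → i' < 5 → i + 2 ≤ i' → Q i ∨ Q i') :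
    ∃ i, (0 ≤ i ∧ i < 5) ∧ P i ∧ Q i := by
  -- The positions `0, 2, 4` are pairwise separated, so `P` and `Q` each fail at one of them at
  -- most.
  have p1 := hP 0 2 (by norm_num) (by norm_num) (by norm_num) (by norm_num) (by norm_num)
  have p2 := hP 0 4 (by norm_num) (by norm_num) (by norm_num) (by norm_num) (by norm_num)
  have p3 := hP 2 4 (by norm_num) (by norm_num) (by norm_num) (by norm_num) (by norm_num)
  have q1 := hQ 0 2 (by norm_num) (by norm_num) (by norm_num) (by norm_num) (by norm_num)
  have q2 := hQ 0 4 (by norm_num) (by norm_num) (by norm_num) (by norm_num) (by norm_num)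
  have q3 := hQ 2 4 (by norm_num) (by norm_num) (by norm_num) (by norm_num) (by norm_num)
  by_cases h0 : P 0 ∧ Q 0
  · exact ⟨0, by norm_num, h0⟩
  by_cases h2 : P 2 ∧ Q 2
  · exact ⟨2, by norm_num, h2⟩
  exact ⟨4, by norm_num, by tauto⟩

section Connect

variable {Ω : Type*} {B : ℤ → ℤ → Set Ω} {ω : Ω}

theorem clean_row_or {n : ℕ} {a b : ℤ} (h : ω ∉ bad B (n + 1) a b) (i i' : ℤ)
    (hi : 0 ≤ i) (hi5 : i < 5) (hi' : 0 ≤ i') (hi5' : i' < 5) (hii : i + 2 ≤ i') :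
    (∀ k : ℤ, 0 ≤ k → k < 5 → ω ∉ bad B n (5 * a + i) (5 * b + k)) ∨
      ∀ k : ℤ, 0 ≤ k → k < 5 → ω ∉ bad B n (5 * a + i') (5 * b + k) := by
  by_contra! hcon
  obtain ⟨⟨k, hk, hk5, h1⟩, k', hk', hk5', h2⟩ := hcon
  refine h (Set.mem_biUnion (x := ((i, k), (i', k'))) ?_ ⟨h1, h2⟩)
  exact mem_separatedPairs.2 ⟨⟨⟨⟨hi, hi5⟩, hk, hk5⟩, ⟨hi', hi5'⟩, hk', hk5'⟩, .inl hii⟩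

theorem clean_col_or {n : ℕ} {a b : ℤ} (h : ω ∉ bad B (n + 1) a b) (j j' : ℤ)
    (hj : 0 ≤ j) (hj5 : j < 5) (hj' : 0 ≤ j') (hj5' : j' < 5) (hjj : j + 2 ≤ j') :
    (∀ k : ℤ, 0 ≤ k → k < 5 → ω ∉ bad B n (5 * a + k) (5 * b + j)) ∨
      ∀ k : ℤ, 0 ≤ k → k < 5 → ω ∉ bad B n (5 * a + k) (5 * b + j') := by
  by_contra! hcon
  obtain ⟨⟨k, hk, hk5, h1⟩, k', hk', hk5', h2⟩ := hcon
  refine h (Set.mem_biUnion (x := ((k, j), (k', j'))) ?_ ⟨h1, h2⟩)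
  exact mem_separatedPairs.2 ⟨⟨⟨⟨hk, hk5⟩, hj, hj5⟩, ⟨hk', hk5'⟩, hj', hj5'⟩, .inr hjj⟩

/-- Consecutively connected nonempty sets are connected. -/
theorem chain_connect {α : Type*} {K : α → α → Prop} (htrans : ∀ x y z, K x y → K y z → K x z)
    (hsymm : ∀ x y, K x y → K y x) {C : ℤ → Set α} (hne : ∀ k : ℤ, 0 ≤ k → k < 5 → (C k).Nonempty)
    (hself : ∀ k : ℤ, 0 ≤ k → k < 5 → ∀ z ∈ C k, ∀ w ∈ C k, K z w)
    (hnext : ∀ k : ℤ, 0 ≤ k → k + 1 < 5 → ∀ z ∈ C k, ∀ w ∈ C (k + 1), K z w)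
    {k l : ℤ} (hk : 0 ≤ k) (hk5 : k < 5) (hl : 0 ≤ l) (hl5 : l < 5) :
    ∀ z ∈ C k, ∀ w ∈ C l, K z w := by
  have key : ∀ n : ℕ, ∀ k : ℤ, 0 ≤ k → k + n < 5 → ∀ z ∈ C k, ∀ w ∈ C (k + n), K z w := by
    intro n
    induction n with
    | zero =>
      intro k hk hk5 z hz w hw
      simp only [Nat.cast_zero, add_zero] at hk5 hw
      exact hself k hk hk5 z hz w hw
    | succ n ih =>
      intro k hk hk5 z hz w hw
      push_cast at hk5 hw
      obtain ⟨u, hu⟩ := hne (k + n) (by omega) (by omega)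
      rw [← add_assoc] at hw
      exact htrans _ _ _ (ih k hk (by omega) z hz u hu)
        (hnext (k + n) (by omega) (by omega) u hu w hw)
  intro z hz w hw
  rcases le_total k l with h | h
  · obtain ⟨n, rfl⟩ := Int.le.dest h
    exact key n k hk hl5 z hz w hw
  · obtain ⟨n, rfl⟩ := Int.le.dest h
    exact hsymm _ _ (key n l hl hk5 w hw z hz)

/-- The three claims need a joint induction: links between neighbouring sub-blocks make clean rows
and columns connected, and these in turn carry the links between neighbouring blocks. A row has a
fixed first coordinate, a column a fixed second one. -/
theorem backbone_connected {K : ℤ × ℤ → ℤ × ℤ → Prop}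
    (htrans : ∀ x y z, K x y → K y z → K x z) (hsymm : ∀ x y, K x y → K y x)
    (h0 : ∀ a b, ω ∉ B a b → K (a, b) (a, b))
    (h1 : ∀ a b, ω ∉ B a b → ω ∉ B (a + 1) b → K (a, b) (a + 1, b))
    (h2 : ∀ a b, ω ∉ B a b → ω ∉ B a (b + 1) → K (a, b) (a, b + 1)) (n : ℕ) :
    (∀ a b, ω ∉ bad B n a b → (backbone B ω n a b).Nonempty ∧
      ∀ z ∈ backbone B ω n a b, ∀ w ∈ backbone B ω n a b, K z w) ∧
    (∀ a b, ω ∉ bad B n a b → ω ∉ bad B n (a + 1) b →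
      ∀ z ∈ backbone B ω n a b, ∀ w ∈ backbone B ω n (a + 1) b, K z w) ∧
    ∀ a b, ω ∉ bad B n a b → ω ∉ bad B n a (b + 1) →
      ∀ z ∈ backbone B ω n a b, ∀ w ∈ backbone B ω n a (b + 1), K z w := by
  induction n with
  | zero =>
    refine ⟨fun a b h => ⟨⟨_, rfl⟩, ?_⟩, fun a b h h' => ?_, fun a b h h' => ?_⟩
    · rintro z rfl w rfl
      exact h0 a b h
    · rintro z rfl w rfl
      exact h1 a b h h'
    · rintro z rfl w rfl
      exact h2 a b h h'
  | succ n ih =>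
    obtain ⟨ih0, ih1, ih2⟩ := ih
    have row : ∀ a b, (∀ k : ℤ, 0 ≤ k → k < 5 → ω ∉ bad B n a (b + k)) →
        ∀ {k l : ℤ}, 0 ≤ k → k < 5 → 0 ≤ l → l < 5 →
        ∀ z ∈ backbone B ω n a (b + k), ∀ w ∈ backbone B ω n a (b + l), K z w := by
      intro a b h k l hk hk5 hl hl5
      refine chain_connect (C := fun k => backbone B ω n a (b + k)) htrans hsymm
        (fun k hk hk5 => (ih0 _ _ (h k hk hk5)).1) (fun k hk hk5 => (ih0 _ _ (h k hk hk5)).2)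
        (fun k hk hk5 => ?_) hk hk5 hl hl5
      have h3 := h (k + 1) (by omega) hk5
      rw [← add_assoc] at h3
      rw [← add_assoc]
      exact ih2 _ _ (h k hk (by omega)) h3
    have col : ∀ a b, (∀ k : ℤ, 0 ≤ k → k < 5 → ω ∉ bad B n (a + k) b) →
        ∀ {k l : ℤ}, 0 ≤ k → k < 5 → 0 ≤ l → l < 5 →
        ∀ z ∈ backbone B ω n (a + k) b, ∀ w ∈ backbone B ω n (a + l) b, K z w := by
      intro a b h k l hk hk5 hl hl5
      refine chain_connect (C := fun k => backbone B ω n (a + k) b) htrans hsymm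
        (fun k hk hk5 => (ih0 _ _ (h k hk hk5)).1) (fun k hk hk5 => (ih0 _ _ (h k hk hk5)).2)
        (fun k hk hk5 => ?_) hk hk5 hl hl5
      have h3 := h (k + 1) (by omega) hk5
      rw [← add_assoc] at h3
      rw [← add_assoc]
      exact ih1 _ _ (h k hk (by omega)) h3
    have conn : ∀ a b, ω ∉ bad B (n + 1) a b → (backbone B ω (n + 1) a b).Nonempty ∧
        ∀ z ∈ backbone B ω (n + 1) a b, ∀ w ∈ backbone B ω (n + 1) a b, K z w := by
      intro a b h
      obtain ⟨i, hi, hri, -⟩ := exists_common_free (clean_row_or h) (clean_row_or h)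
      obtain ⟨j, hj, hcj, -⟩ := exists_common_free (clean_col_or h) (clean_col_or h)
      -- `c` is a hub at the crossing of a clean row and a clean column; every clean row or column
      -- meets one of these two.
      obtain ⟨c, hc⟩ := (ih0 _ _ (hri j hj.1 hj.2)).1
      have hzc : ∀ z ∈ backbone B ω (n + 1) a b, K z c := by
        rintro z ⟨i', j', ⟨hi', hj'⟩, hz, hr | hr⟩
        · obtain ⟨u, hu⟩ := (ih0 _ _ (hr j hj.1 hj.2)).1
          exact htrans _ _ _ (row _ _ hr hj'.1 hj'.2 hj.1 hj.2 z hz u hu)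
            (col _ _ hcj hi'.1 hi'.2 hi.1 hi.2 u hu c hc)
        · obtain ⟨u, hu⟩ := (ih0 _ _ (hr i hi.1 hi.2)).1
          exact htrans _ _ _ (col _ _ hr hi'.1 hi'.2 hi.1 hi.2 z hz u hu)
            (row _ _ hri hj'.1 hj'.2 hj.1 hj.2 u hu c hc)
      exact ⟨⟨c, i, j, ⟨hi, hj⟩, hc, .inl hri⟩, fun z hz w hw =>
        htrans _ _ _ (hzc z hz) (hsymm _ _ (hzc w hw))⟩
    refine ⟨conn, fun a b h h' z hz w hw => ?_, fun a b h h' z hz w hw => ?_⟩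
    -- A column clean in both blocks crosses their common side, from sub-block `4` of the first to
    -- sub-block `0` of the second.
    · obtain ⟨j, hj, hx, hy⟩ := exists_common_free (clean_col_or h) (clean_col_or h')
      obtain ⟨e, he⟩ := (ih0 _ _ (hx 4 (by norm_num) (by norm_num))).1
      obtain ⟨f, hf⟩ := (ih0 _ _ (hy 0 (by norm_num) (by norm_num))).1
      have hef : K e f := by
        have h4 : 5 * (a + 1) + 0 = 5 * a + 4 + 1 := by ring
        have hy0 := hy 0 (by norm_num) (by norm_num)
        rw [h4] at hf hy0
        exact ih1 _ _ (hx 4 (by norm_num) (by norm_num)) hy0 e he f hf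
      exact htrans _ _ _ ((conn a b h).2 z hz e ⟨4, j, ⟨by norm_num, hj⟩, he, .inr hx⟩)
        (htrans _ _ _ hef ((conn _ _ h').2 f ⟨0, j, ⟨by norm_num, hj⟩, hf, .inr hy⟩ w hw))
    · obtain ⟨i, hi, hx, hy⟩ := exists_common_free (clean_row_or h) (clean_row_or h')
      obtain ⟨e, he⟩ := (ih0 _ _ (hx 4 (by norm_num) (by norm_num))).1
      obtain ⟨f, hf⟩ := (ih0 _ _ (hy 0 (by norm_num) (by norm_num))).1
      have hef : K e f := by
        have h4 : 5 * (b + 1) + 0 = 5 * b + 4 + 1 := by ring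
        have hy0 := hy 0 (by norm_num) (by norm_num)
        rw [h4] at hf hy0
        exact ih2 _ _ (hx 4 (by norm_num) (by norm_num)) hy0 e he f hf
      exact htrans _ _ _ ((conn a b h).2 z hz e ⟨i, 4, ⟨hi, by norm_num⟩, he, .inl hx⟩)
        (htrans _ _ _ hef ((conn _ _ h').2 f ⟨i, 0, ⟨hi, by norm_num⟩, hf, .inl hy⟩ w hw))

/-- If at every level the blocks `(0, 0), …, (0, 4)` are good, then the origin is in an infinite
cluster. -/
theorem infinite_cluster_of_good {K : ℤ × ℤ → ℤ × ℤ → Prop}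
    (htrans : ∀ x y z, K x y → K y z → K x z) (hsymm : ∀ x y, K x y → K y x)
    (h0 : ∀ a b, ω ∉ B a b → K (a, b) (a, b))
    (h1 : ∀ a b, ω ∉ B a b → ω ∉ B (a + 1) b → K (a, b) (a + 1, b))
    (h2 : ∀ a b, ω ∉ B a b → ω ∉ B a (b + 1) → K (a, b) (a, b + 1))
    (hω : ∀ n, ∀ j : ℤ, 0 ≤ j → j < 5 → ω ∉ bad B n 0 j) :
    {z | K (0, 0) z}.Infinite := by
  have hconn := backbone_connected htrans hsymm h0 h1 h2
  have hsub : ∀ n (j : ℤ), 0 ≤ j → j < 5 → backbone B ω n 0 j ⊆ backbone B ω (n + 1) 0 0 := by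
    intro n j hj hj5 z hz
    refine ⟨0, j, ⟨by norm_num, hj, hj5⟩, by simpa using hz, .inl fun k hk hk5 => ?_⟩
    simpa using hω n k hk hk5
  have horig : ∀ n, ((0, 0) : ℤ × ℤ) ∈ backbone B ω n 0 0 := by
    intro n
    induction n with
    | zero => rfl
    | succ n ih => exact hsub n 0 le_rfl (by norm_num) ih
  intro hfin
  obtain ⟨M, hM⟩ := (hfin.image Prod.snd).bddAbove
  -- The backbone of block `(0, 4)` joins that of the origin one level up, and its height is at
  -- least `4 * 5 ^ n`, which exceeds any bound `M`.
  obtain ⟨z, hz⟩ := ((hconn M.toNat).1 0 4 (hω _ 4 (by norm_num) (by norm_num))).1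
  have hK := ((hconn (M.toNat + 1)).1 0 0 (hω _ 0 le_rfl (by norm_num))).2 _ (horig _) z
    (hsub _ 4 (by norm_num) (by norm_num) hz)
  have hzM : z.2 ≤ M := hM ⟨z, hK, rfl⟩
  have hz5 := le_of_mem_backbone _ _ _ _ hz
  have hpow : M.toNat < 5 ^ M.toNat := Nat.lt_pow_self (by norm_num)
  zify at hpow
  have := Int.self_le_toNat M
  linarith

end Connect

end Hierarchy

/-! ### Line percolation as a single product measure over all lines. -/

section Lines

variable {d : ℕ}

/-- The parameter of each line. -/
def lineParam (p : Fin d → I) : (Σ i, Hyperplane d i) → I := fun s => p s.1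

/-- The site configuration of a configuration on the set of all lines. -/
def lineSites (ω : (Σ i, Hyperplane d i) → Bool) : Config d :=
  siteConfig d fun i w => ω ⟨i, w⟩

theorem lineSites_eq_true {ω : (Σ i, Hyperplane d i) → Bool} {v : Fin d → ℤ} :
    lineSites ω v = true ↔ ∀ i, ω ⟨i, proj i v⟩ = true := by
  simp [lineSites, siteConfig]

theorem measurable_lineSites : Measurable (lineSites (d := d)) :=
  (measurable_siteConfig d).comp <| measurable_pi_iff.2 fun _ => measurable_pi_iff.2 fun _ =>
    measurable_pi_apply _

theorem linePercolation_eq (p : Fin d → I) :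
    linePercolation d p = (bernoulliProd (lineParam p)).map lineSites := by
  have h : (bernoulliProd (lineParam p)).map (fun ω i w => ω ⟨i, w⟩) =
      Measure.pi fun i => bernoulliField (Hyperplane d i) (p i) := by
    rw [← Measure.infinitePi_eq_pi]
    exact Measure.infinitePi_map_piCurry
      (fun (i : Fin d) (_ : Hyperplane d i) => bernoulliMeasure true false (p i))
  rw [linePercolation, ← h, Measure.map_map (measurable_siteConfig d)]
  · rfl
  · exact measurable_pi_iff.2 fun _ => measurable_pi_iff.2 fun _ => measurable_pi_apply _

end Lines

/-! ### Percolation near the plane `x + y + z = 0` for parameters close to one. -/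

section Plane

variable {d : ℕ}

/-- The point of `ℤ^d` with first three coordinates `x, y, z` and the others zero. -/
def point (d : ℕ) (x y z : ℤ) : Fin d → ℤ :=
  fun i => if i.1 = 0 then x else if i.1 = 1 then y else if i.1 = 2 then z else 0

theorem lattice_adj_of_eq_off {m : ℕ} {v w : Fin m → ℤ} (i : Fin m) (h : ∀ k, k ≠ i → v k = w k)
    (hi : |v i - w i| = 1) : (lattice m).Adj v w := by
  change ∑ k, |v k - w k| = 1
  rw [Finset.sum_eq_single i, hi]
  · intro k _ hk
    simp [h k hk]
  · simp

/-- The three sites that make up a mesoscopic site of the plane `x + y + z = 0`. -/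
def planeSites (d : ℕ) (a b : ℤ) : Finset (Fin d → ℤ) :=
  {point d a b (-a - b), point d (a + 1) b (-a - b), point d a (b + 1) (-a - b)}

/-- The lines through the sites of `planeSites`. -/
def planeLines (d : ℕ) (a b : ℤ) : Set (Σ i, Hyperplane d i) :=
  {s | ∃ u ∈ planeSites d a b, ∃ i, s = ⟨i, proj i u⟩}

/-- Some line through `planeSites` is closed. -/
def planeBad (d : ℕ) (a b : ℤ) : Set ((Σ i, Hyperplane d i) → Bool) :=
  ⋃ u ∈ planeSites d a b, ⋃ i, {ω | ω ⟨i, proj i u⟩ = false}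

theorem measurableSet_planeBad (a b : ℤ) :
    MeasurableSet[coordSigma (planeLines d a b)] (planeBad d a b) := by
  refine Finset.measurableSet_biUnion _ fun u hu => MeasurableSet.iUnion fun i => ?_
  exact measurable_eval_coordSigma (T := planeLines d a b) ⟨u, hu, i, rfl⟩
    (measurableSet_singleton false)

theorem notMem_planeBad {a b : ℤ} {ω : (Σ i, Hyperplane d i) → Bool} :
    ω ∉ planeBad d a b ↔ ∀ u ∈ planeSites d a b, u ∈ openSet (lineSites ω) := by
  simp only [planeBad, Set.mem_iUnion, not_exists, mem_openSet, lineSites_eq_true]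
  refine forall₂_congr fun u hu => forall_congr' fun i => ?_
  simp

theorem proj_eq_iff {i : Fin d} {u v : Fin d → ℤ} : proj i u = proj i v ↔ ∀ k, k ≠ i → u k = v k := by
  rw [Subtype.ext_iff]
  constructor
  · intro h k hk
    have := congrFun h k
    simpa [proj, hk] using this
  · intro h
    ext k
    by_cases hk : k = i
    · subst hk; simp [proj]
    · simp [proj, hk, h k hk]

theorem mem_planeSites {a b : ℤ} {u : Fin d → ℤ} (hu : u ∈ planeSites d a b) :
    ∃ s t : ℤ, 0 ≤ s ∧ 0 ≤ t ∧ s ≤ 1 ∧ t ≤ 1 ∧ u = point d (a + s) (b + t) (-a - b) := by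
  simp only [planeSites, Finset.mem_insert, Finset.mem_singleton] at hu
  rcases hu with rfl | rfl | rfl
  · exact ⟨0, 0, by norm_num, by norm_num, by norm_num, by norm_num, by simp⟩
  · exact ⟨1, 0, by norm_num, by norm_num, by norm_num, by norm_num, by simp⟩
  · exact ⟨0, 1, by norm_num, by norm_num, by norm_num, by norm_num, by simp⟩

/-- A common line forces at least two of the first three coordinates to agree. Since the third is
`-a - b` and the offsets are `0` or `1`, both `a - a'` and `b - b'` then have size at most one. -/
theorem disjoint_planeLines (hd : 3 ≤ d) (a b a' b' : ℤ) (h : 2 ≤ |a - a'| ∨ 2 ≤ |b - b'|) :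
    Disjoint (planeLines d a b) (planeLines d a' b') := by
  refine Set.disjoint_left.2 ?_
  rintro _ ⟨u, hu, i, rfl⟩ ⟨u', hu', i', he⟩
  obtain ⟨rfl, he⟩ := Sigma.mk.inj_iff.1 he
  rw [heq_iff_eq, proj_eq_iff] at he
  obtain ⟨s, t, hs, ht, hs1, ht1, rfl⟩ := mem_planeSites hu
  obtain ⟨s', t', hs', ht', hs1', ht1', rfl⟩ := mem_planeSites hu'
  have h0 : i.1 ≠ 0 → a + s = a' + s' := fun hi => by
    simpa [point] using he ⟨0, by omega⟩ (by rintro rfl; exact hi rfl)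
  have h1 : i.1 ≠ 1 → b + t = b' + t' := fun hi => by
    simpa [point] using he ⟨1, by omega⟩ (by rintro rfl; exact hi rfl)
  have h2 : i.1 ≠ 2 → -a - b = -a' - b' := fun hi => by
    simpa [point] using he ⟨2, by omega⟩ (by rintro rfl; exact hi rfl)
  simp only [le_abs] at h
  by_cases i0 : i.1 = 0
  · have := h1 (by omega); have := h2 (by omega); omega
  by_cases i1 : i.1 = 1
  · have := h0 (by omega); have := h2 (by omega); omega
  have := h0 i0; have := h1 i1; omega

theorem prob_planeBad_le {p : Fin d → I} {ε : ℝ} (hp : ∀ i, 1 - ε < (p i : ℝ)) (a b : ℤ) :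
    bernoulliProd (lineParam p) (planeBad d a b) ≤ 3 * (d * ENNReal.ofReal ε) := by
  calc bernoulliProd (lineParam p) (planeBad d a b)
      ≤ ∑ u ∈ planeSites d a b, bernoulliProd (lineParam p)
          (⋃ i, {ω | ω ⟨i, proj i u⟩ = false}) := measure_biUnion_finset_le _ _
    _ ≤ ∑ u ∈ planeSites d a b, (d * ENNReal.ofReal ε) := by
        refine Finset.sum_le_sum fun u _ => (measure_iUnion_fintype_le _ _).trans ?_
        refine (Finset.sum_le_sum (g := fun _ => ENNReal.ofReal ε) fun i _ => ?_).trans ?_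
        · rw [bernoulliProd_eval_false]
          refine ENNReal.ofReal_le_ofReal ?_
          have := hp i
          simp only [lineParam]
          linarith
        · simp
    _ ≤ 3 * (d * ENNReal.ofReal ε) := by
        rw [Finset.sum_const, nsmul_eq_mul]
        gcongr
        exact_mod_cast Finset.card_le_three

theorem exists_percolation (hd : 3 ≤ d) : ∃ ε : ℝ, 0 < ε ∧ ∀ p : Fin d → I,
    (∀ i, 1 - ε < (p i : ℝ)) → 0 < linePercolation d p (connInfty d) := by
  have hd0 : (0 : ℝ) < d := by exact_mod_cast (by omega : 0 < d)
  -- Three sites with `d` lines each give `3 * d * ε = 1 / 1250`, the threshold of the block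
  -- recursion.
  refine ⟨1 / (3750 * d), by positivity, fun p hp => ?_⟩
  have hB0 : ∀ a b, bernoulliProd (lineParam p) (planeBad d a b) ≤ 625⁻¹ * 2⁻¹ := by
    intro a b
    refine (prob_planeBad_le hp a b).trans (le_of_eq ?_)
    rw [← ENNReal.ofReal_natCast, ← ENNReal.ofReal_mul hd0.le]
    have h3 : (3 : ENNReal) = ENNReal.ofReal 3 := by simp
    have h4 : (625 : ENNReal) = ENNReal.ofReal 625 := by simp
    have h5 : (2 : ENNReal) = ENNReal.ofReal 2 := by simp
    rw [h3, h4, h5, ← ENNReal.ofReal_inv_of_pos (by norm_num),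
      ← ENNReal.ofReal_inv_of_pos (by norm_num), ← ENNReal.ofReal_mul (by norm_num),
      ← ENNReal.ofReal_mul (by norm_num)]
    congr 1
    field_simp
    norm_num
  rw [linePercolation_eq, Measure.map_apply measurable_lineSites measurableSet_connInfty]
  refine (prob_forall_good_pos measurableSet_planeBad (disjoint_planeLines hd) hB0).trans_le
    (measure_mono ?_)
  intro ω hω
  let v : ℤ × ℤ → Fin d → ℤ := fun z => point d z.1 z.2 (-z.1 - z.2)
  have hv : Function.Injective v := by
    rintro ⟨a, b⟩ ⟨a', b'⟩ h
    have h0 := congrFun h ⟨0, by omega⟩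
    have h1 := congrFun h ⟨1, by omega⟩
    simp only [v, point] at h0 h1
    simp_all
  have hv0 : v (0, 0) = 0 := by
    ext i
    simp [v, point]
  have hadj0 : ∀ x y z : ℤ, (lattice d).Adj (point d x y z) (point d (x + 1) y z) := fun x y z => by
    refine lattice_adj_of_eq_off ⟨0, by omega⟩ (fun k hk => ?_) (by simp [point])
    have : k.1 ≠ 0 := fun h => hk (Fin.ext h)
    simp [point, this]
  have hadj1 : ∀ x y z : ℤ, (lattice d).Adj (point d x y z) (point d x (y + 1) z) := fun x y z => by
    refine lattice_adj_of_eq_off ⟨1, by omega⟩ (fun k hk => ?_) (by simp [point])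
    have : k.1 ≠ 1 := fun h => hk (Fin.ext h)
    simp [point, this]
  have hadj2 : ∀ x y z : ℤ, (lattice d).Adj (point d x y z) (point d x y (z - 1)) := fun x y z => by
    refine lattice_adj_of_eq_off ⟨2, by omega⟩ (fun k hk => ?_) (by simp [point])
    have : k.1 ≠ 2 := fun h => hk (Fin.ext h)
    simp [point, this]
  have hopen : ∀ a b, ω ∉ planeBad d a b → v (a, b) ∈ openSet (lineSites ω) := fun a b h =>
    notMem_planeBad.1 h _ (by simp [planeSites, v])
  have hinf := infinite_cluster_of_good (B := planeBad d) (ω := ω)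
    (K := fun z w => Link (lattice d) (openSet (lineSites ω)) (v z) (v w))
    (fun _ _ _ h h' => h.trans h') (fun _ _ h => h.symm) (fun a b h => .refl (hopen a b h))
    (fun a b h h' => by
      -- A neighbour in the plane is two lattice steps away, and the intermediate site belongs to
      -- the mesoscopic site `(a, b)`.
      have hmid := notMem_planeBad.1 h (point d (a + 1) b (-a - b)) (by simp [planeSites])
      refine (Link.of_adj (hopen a b h) hmid (hadj0 _ _ _)).tail ?_ (hopen _ _ h')
      have := hadj2 (a + 1) b (-a - b)
      rwa [show -a - b - 1 = -(a + 1) - b by ring] at this)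
    (fun a b h h' => by
      have hmid := notMem_planeBad.1 h (point d a (b + 1) (-a - b)) (by simp [planeSites])
      refine (Link.of_adj (hopen a b h) hmid (hadj1 _ _ _)).tail ?_ (hopen _ _ h')
      have := hadj2 a (b + 1) (-a - b)
      rwa [show -a - b - 1 = -a - (b + 1) by ring] at this) hω
  refine mem_connInfty_iff.2 ((hinf.image hv.injOn).mono ?_)
  rintro _ ⟨z, hz, rfl⟩
  rw [← hv0]
  exact hz

end Plane

/-! ### Projection along a coordinate direction, and exponential decay. -/

section Projection

variable {m : ℕ}

/-- The configuration of the lines parallel to `e_i`, seen as a site configuration on `ℤ^m`. -/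
def sliceConfig (i : Fin (m + 1)) (ω : (Σ i, Hyperplane (m + 1) i) → Bool) : Config m :=
  fun w => ω ⟨i, ⟨i.insertNth 0 w, by simp⟩⟩

theorem sliceConfig_removeNth (i : Fin (m + 1)) (ω : (Σ i, Hyperplane (m + 1) i) → Bool)
    (v : Fin (m + 1) → ℤ) : sliceConfig i ω (i.removeNth v) = ω ⟨i, proj i v⟩ := by
  have : (⟨i.insertNth 0 (i.removeNth v), by simp⟩ : Hyperplane (m + 1) i) = proj i v := by
    refine Subtype.ext ?_
    simp [proj]
  rw [sliceConfig, this]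

theorem measurable_sliceConfig (i : Fin (m + 1)) : Measurable (sliceConfig i) :=
  measurable_pi_iff.2 fun _ => measurable_pi_apply _

theorem map_sliceConfig (p : Fin (m + 1) → I) (i : Fin (m + 1)) :
    (bernoulliProd (lineParam p)).map (sliceConfig i) = bernoulliProd fun _ => p i := by
  refine bernoulliProd_map (lineParam p)
    (f := fun w : Fin m → ℤ => ⟨i, ⟨i.insertNth 0 w, by simp⟩⟩) ?_
  intro w w' h
  have h' := congrArg Subtype.val (eq_of_heq (Sigma.mk.inj_iff.1 h).2)
  have := congrArg i.removeNth h'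
  simpa using this

theorem prob_sliceConfig (p : Fin (m + 1) → I) (i : Fin (m + 1)) {A : Set (Config m)}
    (hA : MeasurableSet A) : bernoulliProd (lineParam p) (sliceConfig i ⁻¹' A) =
      bernoulliProd (fun _ => p i) A := by
  rw [← map_sliceConfig, Measure.map_apply (measurable_sliceConfig i) hA]

/-- A lattice step either is parallel to `e_i` and projects to a point, or projects to a lattice
step. -/
theorem Link.slice (i : Fin (m + 1)) {ω : (Σ i, Hyperplane (m + 1) i) → Bool}
    {x y : Fin (m + 1) → ℤ} (h : Link (lattice (m + 1)) (openSet (lineSites ω)) x y) :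
    Link (lattice m) (openSet (sliceConfig i ω)) (i.removeNth x) (i.removeNth y) := by
  refine h.map (fun a b hab => ?_) fun a ha => ?_
  · have hs : ∑ k, |a k - b k| = 1 := hab
    rw [Fin.sum_univ_succAbove _ i] at hs
    have h0 : 0 ≤ ∑ k, |a (i.succAbove k) - b (i.succAbove k)| :=
      Finset.sum_nonneg fun _ _ => abs_nonneg _
    rcases h0.eq_or_lt with h0 | h0
    · right
      ext k
      have := (Finset.sum_eq_zero_iff_of_nonneg fun k _ => abs_nonneg _).1 h0.symm k
        (Finset.mem_univ k)
      exact sub_eq_zero.1 (abs_eq_zero.1 this)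
    · left
      change ∑ k, |a (i.succAbove k) - b (i.succAbove k)| = 1
      have := abs_nonneg (a i - b i)
      omega
  · rw [mem_openSet, sliceConfig_removeNth]
    exact lineSites_eq_true.1 ha i

theorem connBoundary_subset_reach (d n : ℕ) : connBoundary d n ⊆ reach (lattice d) 0 (far d n) := by
  rintro η ⟨v, ⟨-, w, hvw, hw⟩, γ, -, hγ⟩
  refine ⟨v, ?_, .of_walk γ hγ⟩
  obtain ⟨k, hk⟩ := not_mem_box_iff.1 hw
  have h1 := lattice_adj_coord hvw k
  have h2 := abs_sub_abs_le_abs_sub (w k) (v k)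
  rw [abs_sub_comm] at h1
  refine ⟨k, ?_⟩
  push_cast at hk
  linarith

/-- The prefactor `2` is absorbed by enlarging the rate from `r` to `s`, which works for large `n`.
The uniform bound `a < 1` covers the remaining `n`. -/
theorem exists_exp_bound {f : ℕ → ENNReal} {a : ℝ} (ha : a < 1)
    (hf : ∀ n, f n ≤ ENNReal.ofReal a) {r : ENNReal} (hr : r < 1) {L : ℕ} (hL : 0 < L)
    (hfr : ∀ n, f n ≤ 2 * r ^ (n / L)) :
    ∃ ψ : ℝ, 0 < ψ ∧ ∀ n : ℕ, f n ≤ ENNReal.ofReal (Real.exp (-ψ * n)) := by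
  lift r to NNReal using hr.ne_top
  have hr' : (r : ℝ) < 1 := by exact_mod_cast hr
  have hr0 : (0 : ℝ) ≤ r := r.2
  set s : ℝ := (1 + r) / 2 with hs
  have hs0 : 0 < s := by positivity
  have hrs : r / s < 1 := by rw [div_lt_one hs0]; linarith
  obtain ⟨K, hK⟩ := exists_pow_lt_of_lt_one (show (0 : ℝ) < 1 / 2 by norm_num) hrs
  set t : ℝ := max s a with ht
  have ht0 : 0 < t := lt_max_of_lt_left hs0
  have ht1 : t < 1 := max_lt (by linarith) ha
  have hlog : 0 < -Real.log t := neg_pos.2 (Real.log_neg ht0 ht1)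
  have hL0 : (0 : ℝ) < L := by exact_mod_cast hL
  refine ⟨-Real.log t / (2 * L * (K + 1)), by positivity, fun n => ?_⟩
  have hdiv : n < (n / L + 1) * L := by
    rw [mul_comm]; exact Nat.lt_mul_div_succ n hL
  have hpos : (0 : ℝ) < 2 * L * (K + 1) := by positivity
  rcases le_or_gt (n / L) K with hk | hk
  · refine (hf n).trans (ENNReal.ofReal_le_ofReal ((le_max_right s a).trans ?_))
    have hn : (n : ℝ) ≤ 2 * L * (K + 1) := by
      have : n ≤ 2 * L * (K + 1) := by nlinarith
      exact_mod_cast this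
    refine (Real.exp_log ht0).symm.le.trans (Real.exp_le_exp.2 ?_)
    rw [neg_mul, div_mul_eq_mul_div, le_neg, div_le_iff₀ hpos]
    exact mul_le_mul_of_nonneg_left hn hlog.le
  · set k := n / L
    have h2 : 2 * (r : ℝ) ^ k ≤ t ^ k := by
      have h3 : ((r : ℝ) / s) ^ k ≤ 1 / 2 :=
        (pow_le_pow_of_le_one (by positivity) hrs.le hk.le).trans hK.le
      rw [div_pow, div_le_iff₀ (by positivity)] at h3
      have h4 : s ^ k ≤ t ^ k := pow_le_pow_left₀ hs0.le (le_max_left _ _) k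
      linarith
    have h5 : (2 * (r : ENNReal) ^ k) = ENNReal.ofReal (2 * (r : ℝ) ^ k) := by
      rw [ENNReal.ofReal_mul (by norm_num), ENNReal.ofReal_pow hr0, ENNReal.ofReal_coe_nnreal]
      simp
    refine (hfr n).trans (h5.le.trans (ENNReal.ofReal_le_ofReal (h2.trans ?_)))
    have hn : (n : ℝ) ≤ k * (2 * L * (K + 1)) := by
      have h6 : n ≤ 2 * k * L := by nlinarith
      have h7 : n ≤ k * (2 * L * (K + 1)) := by nlinarith [Nat.zero_le (k * L * K)]
      exact_mod_cast h7
    rw [← Real.exp_log (pow_pos ht0 k), Real.log_pow]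
    refine Real.exp_le_exp.2 ?_
    rw [neg_mul, div_mul_eq_mul_div, le_neg, div_le_iff₀ hpos]
    have := mul_le_mul_of_nonneg_left hn hlog.le
    linarith

theorem connBoundary_exponential_decay (p : Fin (m + 1) → I) {i j : Fin (m + 1)} (hij : i ≠ j)
    (hi : (p i : ℝ) < criticalProb m) (hj : (p j : ℝ) < criticalProb m) :
    ∃ ψ : ℝ, 0 < ψ ∧ ∀ n : ℕ, linePercolation (m + 1) p (connBoundary (m + 1) n) ≤
      ENNReal.ofReal (Real.exp (-ψ * n)) := by
  obtain ⟨r, hr, L, hL, hrL⟩ := exists_exponential_decay hi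
  obtain ⟨r', hr', L', hL', hrL'⟩ := exists_exponential_decay hj
  have hle : ∀ n, linePercolation (m + 1) p (connBoundary (m + 1) n) ≤
      bernoulliProd (lineParam p)
        {ω | lineSites ω ∈ reach (lattice (m + 1)) 0 (far (m + 1) n)} := by
    intro n
    rw [linePercolation_eq]
    refine (measure_mono (connBoundary_subset_reach _ n)).trans_eq ?_
    exact Measure.map_apply measurable_lineSites (measurableSet_reach _ _ _)
  have hzero : ∀ k : Fin (m + 1), k.removeNth (0 : Fin (m + 1) → ℤ) = 0 := fun k => rfl
  have hmono : ∀ (q : I) (r : ENNReal), r < 1 → ∀ R, r ≤ R → R < 1 → ∀ L M : ℕ, 0 < L → 0 < M →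
      (∀ k, bernoulliProd (fun _ => q) (reach (lattice m) 0 (far m (k * L))) ≤ r ^ k) →
      ∀ n, bernoulliProd (fun _ => q) (reach (lattice m) 0 (far m n)) ≤ R ^ (n / (L * M)) := by
    intro q r _ R hrR hR1 L M hL hM h n
    refine (measure_mono (reach_mono (far_anti (?_ : n / (L * M) * L ≤ n)))).trans
      ((h _).trans (pow_le_pow_left' hrR _))
    calc n / (L * M) * L ≤ n / (L * M) * (L * M) :=
          Nat.mul_le_mul_left _ (Nat.le_mul_of_pos_right L hM)
      _ ≤ n := Nat.div_mul_le_self _ _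
  refine exists_exp_bound (a := p i) (hi.trans_le (criticalProb_le_one m)) (fun n => ?_)
    (r := max r r') (max_lt hr hr') (L := L * L') (Nat.mul_pos hL hL') fun n => ?_
  -- No connection starts at the origin unless the line parallel to `e_i` through it is open.
  · refine (hle n).trans ?_
    have h := bernoulliProd_eval (lineParam p) ⟨i, proj i 0⟩
    change _ = ENNReal.ofReal (p i) at h
    rw [← h]
    refine measure_mono ?_
    rintro ω ⟨z, -, hl⟩
    exact lineSites_eq_true.1 hl.left i
  · have hsub : {ω | lineSites ω ∈ reach (lattice (m + 1)) 0 (far (m + 1) n)} ⊆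
        sliceConfig i ⁻¹' reach (lattice m) 0 (far m n) ∪
          sliceConfig j ⁻¹' reach (lattice m) 0 (far m n) := by
      rintro ω ⟨z, ⟨k, hk⟩, hl⟩
      have key : ∀ l : Fin (m + 1), k ≠ l → sliceConfig l ω ∈ reach (lattice m) 0 (far m n) := by
        intro l hkl
        obtain ⟨k', rfl⟩ := Fin.exists_succAbove_eq hkl
        exact ⟨l.removeNth z, ⟨k', hk⟩, hzero l ▸ hl.slice l⟩
      by_cases hki : k = i
      · exact .inr (key j (hki ▸ hij))
      · exact .inl (key i hki)
    refine ((hle n).trans (measure_mono hsub)).trans ((measure_union_le _ _).trans ?_)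
    rw [prob_sliceConfig p i (measurableSet_reach _ _ _),
      prob_sliceConfig p j (measurableSet_reach _ _ _), two_mul]
    refine add_le_add
      (hmono _ r hr _ (le_max_left _ _) (max_lt hr hr') L L' hL hL' hrL n) ?_
    rw [mul_comm L L']
    exact hmono _ r' hr' _ (le_max_right _ _) (max_lt hr hr') L' L hL' hL hrL' n

/-! ### Blocked heights and the absence of percolation. -/

/-- Among infinitely many disjoint sets of lines of bounded size, one is closed. -/
theorem prob_no_closed_eq_zero {ι : Type*} (q : ι → I) {F : ℕ → Finset ι}
    (hF : ∀ k n, k < n → Disjoint (F k) (F n)) {δ : ENNReal} (hδ : 0 < δ)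
    (hq : ∀ n, δ ≤ bernoulliProd q {ω | ∀ s ∈ F n, ω s = false}) :
    bernoulliProd q {ω | ∀ n, ¬ ∀ s ∈ F n, ω s = false} = 0 := by
  have hm : ∀ n, MeasurableSet[coordSigma (F n : Set ι)] {ω : ι → Bool | ∀ s ∈ F n, ω s = false} := by
    intro n
    refine measurableSet_of_dependsOn (F n) subset_rfl fun ω ω' h hω i hi => ?_
    rw [← h i hi]; exact hω i hi
  have hbound : ∀ n, bernoulliProd q {ω | ∀ k < n, ¬ ∀ s ∈ F k, ω s = false} ≤ (1 - δ) ^ n := by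
    intro n
    induction n with
    | zero => simp
    | succ n ih =>
      have hset : {ω : ι → Bool | ∀ k < n + 1, ¬ ∀ s ∈ F k, ω s = false} =
          {ω | ∀ k < n, ¬ ∀ s ∈ F k, ω s = false} ∩ {ω | ∀ s ∈ F n, ω s = false}ᶜ := by
        ext ω
        constructor
        · exact fun h => ⟨fun k hk => h k (by omega), h n (by omega)⟩
        · rintro ⟨h, h'⟩ k hk
          rcases Nat.lt_succ_iff_lt_or_eq.1 hk with h1 | rfl
          exacts [h k h1, h']
      have hpast : MeasurableSet[coordSigma (⋃ k < n, (F k : Set ι))]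
          {ω : ι → Bool | ∀ k < n, ¬ ∀ s ∈ F k, ω s = false} := by
        have : {ω : ι → Bool | ∀ k < n, ¬ ∀ s ∈ F k, ω s = false} =
            ⋂ k < n, {ω | ∀ s ∈ F k, ω s = false}ᶜ := by ext ω; simp
        rw [this]
        refine MeasurableSet.iInter fun k => MeasurableSet.iInter fun hk => ?_
        have hsub : (F k : Set ι) ⊆ ⋃ k < n, (F k : Set ι) := fun x hx => Set.mem_biUnion hk hx
        exact (coordSigma_mono hsub _ (hm k)).compl
      have hdisj : Disjoint (⋃ k < n, (F k : Set ι)) (F n) := by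
        simp only [Set.disjoint_iUnion_left]
        exact fun k hk => Finset.disjoint_coe.2 (hF k n hk)
      rw [hset, bernoulliProd_inter q hdisj hpast (hm n).compl, pow_succ]
      refine mul_le_mul' ih ?_
      rw [prob_compl_eq_one_sub (coordSigma_le _ _ (hm n))]
      exact tsub_le_tsub_left (hq n) 1
  have hlim := ENNReal.tendsto_pow_atTop_nhds_zero_of_lt_one
    (ENNReal.sub_lt_self ENNReal.one_ne_top one_ne_zero hδ.ne')
  refine le_antisymm (ge_of_tendsto' hlim fun n => (measure_mono ?_).trans (hbound n)) zero_le
  exact fun ω h k _ => h k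

theorem ae_exists_blocked_height (p : Fin (m + 1) → I) {i j : Fin (m + 1)} (hij : j ≠ i)
    (hj : p j ≠ 1) (C : Finset (Fin m → ℤ)) {h : ℕ → ℤ} (hh : Function.Injective h) :
    ∀ᵐ ω ∂bernoulliProd (lineParam p), ∃ n, ∀ c ∈ C, ω ⟨j, proj j (i.insertNth (h n) c)⟩ = false := by
  classical
  let F : ℕ → Finset (Σ i, Hyperplane (m + 1) i) := fun n =>
    C.image fun c => ⟨j, proj j (i.insertNth (h n) c)⟩
  have hF : ∀ k n, k < n → Disjoint (F k) (F n) := by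
    intro k n hkn
    refine Finset.disjoint_left.2 fun s hs hs' => ?_
    obtain ⟨c, -, rfl⟩ := Finset.mem_image.1 hs
    obtain ⟨c', -, he⟩ := Finset.mem_image.1 hs'
    have h1 := proj_eq_iff.1 (eq_of_heq (Sigma.mk.inj_iff.1 he).2) i hij.symm
    simp only [Fin.insertNth_apply_same] at h1
    exact hkn.ne' (hh h1)
  have hj1 : (p j : ℝ) < 1 := lt_of_le_of_ne (p j).2.2 fun h => hj (Subtype.ext h)
  have hx : ENNReal.ofReal (1 - p j) ≤ 1 := by
    rw [← ENNReal.ofReal_one]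
    exact ENNReal.ofReal_le_ofReal (by linarith [(p j).2.1])
  have hq : ∀ n, ENNReal.ofReal (1 - p j) ^ C.card ≤
      bernoulliProd (lineParam p) {ω | ∀ s ∈ F n, ω s = false} := by
    intro n
    rw [bernoulliProd_forall_eq (lineParam p) (F n) fun _ => false]
    refine (pow_le_pow_right_of_le_one' hx
      (show (F n).card ≤ C.card from Finset.card_image_le)).trans_eq ?_
    rw [← Finset.prod_const]
    refine Finset.prod_congr rfl fun s hs => ?_
    obtain ⟨c, -, rfl⟩ := Finset.mem_image.1 hs
    exact (bernoulliMeasure_false (p j)).symm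
  have := prob_no_closed_eq_zero (lineParam p) hF
    (ENNReal.pow_pos (ENNReal.ofReal_pos.2 (by linarith)) _) hq
  rw [ae_iff]
  refine measure_mono_null ?_ this
  exact fun ω hω n hn => hω ⟨n, fun c hc => hn _ (Finset.mem_image_of_mem _ hc)⟩

theorem connInfty_eq_zero (p : Fin (m + 1) → I) {i j : Fin (m + 1)} (hij : j ≠ i)
    (hi : (p i : ℝ) < criticalProb m) (hj : p j ≠ 1) :
    linePercolation (m + 1) p (connInfty (m + 1)) = 0 := by
  rw [linePercolation_eq, Measure.map_apply measurable_lineSites measurableSet_connInfty]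
  have h1 : ∀ᵐ ω ∂bernoulliProd (lineParam p), sliceConfig i ω ∉ connInfty m := by
    rw [ae_iff]
    simp only [not_not]
    exact (prob_sliceConfig p i measurableSet_connInfty).trans (connInfty_prob_eq_zero hi)
  -- The finite set met by the projection is random, so all of the countably many `C` are treated at
  -- once. The shifts by one keep the blocked heights strictly above and below the origin.
  have h2 : ∀ᵐ ω ∂bernoulliProd (lineParam p), ∀ C : Finset (Fin m → ℤ),
      ∃ n : ℕ, ∀ c ∈ C, ω ⟨j, proj j (i.insertNth ((n : ℤ) + 1) c)⟩ = false :=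
    ae_all_iff.2 fun C => ae_exists_blocked_height p hij hj C fun a b hab => by
      omega
  have h3 : ∀ᵐ ω ∂bernoulliProd (lineParam p), ∀ C : Finset (Fin m → ℤ),
      ∃ n : ℕ, ∀ c ∈ C, ω ⟨j, proj j (i.insertNth (-(n : ℤ) - 1) c)⟩ = false :=
    ae_all_iff.2 fun C => ae_exists_blocked_height p hij hj C fun a b hab => by
      omega
  have h4 : ∀ᵐ ω ∂bernoulliProd (lineParam p), lineSites ω ∉ connInfty (m + 1) := by
    filter_upwards [h1, h2, h3] with ω h1 h2 h3
    rintro ⟨γ, h0, hinj, hadj, ho⟩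
    rw [mem_connInfty_iff, Set.not_infinite] at h1
    have hC : ∀ k, i.removeNth (γ k) ∈ h1.toFinset := by
      intro k
      have := (Link.of_seq hadj ho k).slice i
      rw [h0] at this
      rw [Set.Finite.mem_toFinset]
      exact this
    obtain ⟨a, ha⟩ := h2 h1.toFinset
    obtain ⟨b, hb⟩ := h3 h1.toFinset
    have hne : ∀ (z : ℤ), (∀ c ∈ h1.toFinset, ω ⟨j, proj j (i.insertNth z c)⟩ = false) →
        ∀ k, γ k i ≠ z := by
      rintro _ hz k rfl
      have := hz _ (hC k)
      rw [Fin.insertNth_self_removeNth] at this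
      have hopen := lineSites_eq_true.1 (ho k) j
      rw [this] at hopen
      exact Bool.false_ne_true hopen
    -- Each step changes the height by at most one, so the path cannot jump over a blocked height.
    have hheight : ∀ k, -(b : ℤ) - 1 < γ k i ∧ γ k i < (a : ℤ) + 1 := by
      intro k
      induction k with
      | zero => rw [h0]; simp only [Pi.zero_apply]; omega
      | succ k ih =>
        have e1 := abs_le.1 (lattice_adj_coord (hadj k) i)
        have e2 := hne _ ha (k + 1)
        have e3 := hne _ hb (k + 1)
        omega
    refine Set.infinite_range_of_injective hinj ((((Set.finite_Ioo (-(b : ℤ) - 1) (a + 1)).prod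
      h1.toFinset.finite_toSet).image fun t => i.insertNth (α := fun _ => ℤ) t.1 t.2).subset ?_)
    rintro _ ⟨k, rfl⟩
    exact ⟨(γ k i, i.removeNth (γ k)), ⟨hheight k, hC k⟩, Fin.insertNth_self_removeNth i (γ k)⟩
  rw [ae_iff] at h4
  simp only [not_not] at h4
  exact h4

end Projection

end LinePercolation

theorem theorem1 (d : ℕ) (hd : 3 ≤ d) :
    (∀ p : Fin d → unitInterval,
      (∃ i j : Fin d, j ≠ i ∧ (p i : ℝ) < LinePercolation.criticalProb (d - 1) ∧ p j ≠ 1) →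
        LinePercolation.linePercolation d p (LinePercolation.connInfty d) = 0) ∧
    (∃ ε : ℝ, 0 < ε ∧ ∀ p : Fin d → unitInterval, (∀ i, 1 - ε < (p i : ℝ)) →
        0 < LinePercolation.linePercolation d p (LinePercolation.connInfty d)) ∧
    (∀ p : Fin d → unitInterval,
      (∃ i j : Fin d, i ≠ j ∧ (p i : ℝ) < LinePercolation.criticalProb (d - 1) ∧
          (p j : ℝ) < LinePercolation.criticalProb (d - 1)) →
        ∃ ψ : ℝ, 0 < ψ ∧ ∀ n : ℕ,
          LinePercolation.linePercolation d p (LinePercolation.connBoundary d n) ≤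
            ENNReal.ofReal (Real.exp (-ψ * n))) := by
  obtain ⟨m, rfl⟩ : ∃ m, d = m + 1 := ⟨d - 1, by omega⟩
  refine ⟨?_, LinePercolation.exists_percolation hd, ?_⟩
  · rintro p ⟨i, j, hij, hi, hj⟩
    exact LinePercolation.connInfty_eq_zero p hij hi hj
  · rintro p ⟨i, j, hij, hi, hj⟩
    exact LinePercolation.connBoundary_exponential_decay p hij hi hj
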